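/- Let $\mathcal G=(V,E)$ be a finite undirected graph, with $V=\{1,\dots,n\}$, in which every vertex carries a self-loop, and let $\alpha,\beta\in\mathbb R$ satisfy $0<\beta-\alpha<\pi$. **Phase-bounded matrices.** A matrix $C\in\mathbb C^{n\times n}$ is semisectorial if $0$ is not an interior point of its numerical range $\{x^*Cx : x\in\mathbb{C}^n,\ x^*x=1\}$. Such a matrix is $*$-congruent to $$0_k\oplus\bigoplus_{j=1}^{l}e^{i\alpha_j}\oplus\bigoplus_{j=1}^{m}e^{i\gamma}\begin{bmatrix}1&2\\0&1\end{bmatrix},$$ and a set of phases of $C$ consists of $\alpha_1,\dots,\alpha_l$ together with $m$ copies of each of $\gamma+\frac{\pi}{2}$ and $\gamma-\frac{\pi}{2}$, where the arguments (determined modulo $2\pi$) are chosen so that all phases lie in a closed interval of length $\pi$. Let $\mathcal C[\alpha,\beta]$ be the set of semisectorial matrices, of the size clear from the context, whose phases can be chosen in $[\alpha,\beta]$; the zero matrix has no phases and belongs to $\mathcal C[\alpha,\beta]$. **Four cones.** For a set $F\subseteq V\times V$, let $\mathbb C^{n\times n}_{F}$ be the set of $C\in\mathbb{C}^{n\times n}$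 with $C_{ij}=0$ whenever $(i,j)\notin F$, and let $E^c=(V\times V)\setminus E$. Define - $\mathrm{PB}(\mathcal G)=\mathbb C^{n\times n}_{E}\cap\mathcal C[\alpha,\beta]$ (phase-bounded matrices with sparsity pattern $\mathcal G$); - $\mathrm{PPB}(\mathcal G)=\{C\in\mathbb C^{n\times n} : C[\mathcal K]\in\mathcal C[\alpha,\beta]\text{ for all cliques }\mathcal K\text{ of }\mathcal G\}$, where $C[\mathcal K]$ is the principal submatrix indexed by $\mathcal K$ (partially phase-bounded matrices); - $\mathrm{COMP}(\mathcal G)=\{C\in\mathbb C^{n\times n} : \exists B\in\mathbb C^{n\times n}_{E^c},\ C+B\in\mathcal C[\alpha,\beta]\}$ (completable matrices); - $\mathrm{DCOMP}(\mathcal G)=\{C\in\mathbb C^{n\times n}_{E} : C=\sum_{i=1}^{N}C_i\text{ for some }N\ge 0\text{ and }C_i\in\mathrm{PB}(\mathcal G)\text{ with }\operatorname{rank}C_i=1\}$ (decomposable matrices; the empty sum $N=0$ gives the zero matrix). Let $\mathbb H^n$ be the real space of Hermitian $n\times n$ matrices. The realification of a set $S\subseteq\mathbb C^{n\times n}$ is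 $\widetilde S=\{(H,K)\in\mathbb H^n\times\mathbb H^n : H+iK\in S\}$. **Theorem.** The following statements are equivalent: 1. $\mathcal G$ is chordal, i.e. every simple cycle of length at least $4$ has a chord (an edge joining two nonconsecutive vertices of the cycle); 2. $\widetilde{\mathrm{DCOMP}}(\mathcal G)=\widetilde{\mathrm{PB}}(\mathcal G)$; 3. $\widetilde{\mathrm{COMP}}(\mathcal G)=\widetilde{\mathrm{PPB}}(\mathcal G)$. -/

import Mathlib

open Matrix

noncomputable section

namespace PhaseBounded

/-! ### Numerical range, semisectorial matrices, phases -/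

/-- The numerical range `{x* C x : x* x = 1}` of a square complex matrix. -/
def numericalRange {n : Type*} [Fintype n] (C : Matrix n n ℂ) : Set ℂ :=
  {z | ∃ x : n → ℂ, star x ⬝ᵥ x = 1 ∧ z = star x ⬝ᵥ (C *ᵥ x)}

/-- A matrix is semisectorial if the origin is not an interior point of its numerical range. -/
def IsSemisectorial {n : Type*} [Fintype n] (C : Matrix n n ℂ) : Prop :=
  (0 : ℂ) ∉ interior (numericalRange C)

/-- The canonical form of a semisectorial matrix under `*`-congruence: the direct sum of a zero
block of size `k`, of the `1 × 1` blocks `exp (i a j)` for `j < l`, and of `m` copies of the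
`2 × 2` block `exp (i γ) [1 2; 0 1]`. -/
def canonicalForm (k l m : ℕ) (a : Fin l → ℝ) (γ : ℝ) :
    Matrix (Fin k ⊕ (Fin l ⊕ Fin 2 × Fin m)) (Fin k ⊕ (Fin l ⊕ Fin 2 × Fin m)) ℂ :=
  fromBlocks 0 0 0
    (fromBlocks (diagonal fun j => Complex.exp (Complex.I * (a j : ℂ))) 0 0
      (blockDiagonal fun _ : Fin m =>
        Complex.exp (Complex.I * (γ : ℂ)) • !![(1 : ℂ), 2; 0, 1]))

/-- The phases read off from the canonical form: the numbers `a j`, and `m` copies of each of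
`γ + π / 2` and `γ - π / 2`. Their number is the rank of the matrix. -/
def canonicalPhases (l m : ℕ) (a : Fin l → ℝ) (γ : ℝ) : Multiset ℝ :=
  Finset.univ.val.map a + Multiset.replicate m (γ + Real.pi / 2)
    + Multiset.replicate m (γ - Real.pi / 2)

/-- `φ` is a set of phases (with multiplicities) of the matrix `C`: `C` is semisectorial, it is
congruent to a canonical form whose phases are `φ`, and `φ` lies in a closed interval of
length `π`. The arguments in the canonical form are determined only modulo `2 π`, so a matrix
has many sets of phases. -/
def IsPhaseSet {n : Type*} [Fintype n] [DecidableEq n] (C : Matrix n n ℂ) (φ : Multiset ℝ) :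
    Prop :=
  IsSemisectorial C ∧
  (∃ (k l m : ℕ) (a : Fin l → ℝ) (γ : ℝ) (e : Fin k ⊕ (Fin l ⊕ Fin 2 × Fin m) ≃ n)
      (T : Matrix n n ℂ),
    IsUnit T ∧ C = T * (canonicalForm k l m a γ).reindex e e * Tᴴ ∧
      φ = canonicalPhases l m a γ) ∧
  ∃ θ : ℝ, ∀ x ∈ φ, θ ≤ x ∧ x ≤ θ + Real.pi

/-- The cone of semisectorial matrices whose phases can be chosen in `[α, β]`. The zero matrix
has no phases and belongs to the cone (its smallest and largest phases are `∞` and `-∞`). -/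
def pbCone {n : Type*} [Fintype n] [DecidableEq n] (α β : ℝ) : Set (Matrix n n ℂ) :=
  {C | ∃ φ : Multiset ℝ, IsPhaseSet C φ ∧ ∀ x ∈ φ, α ≤ x ∧ x ≤ β}

/-! ### Graphs and sparsity patterns -/

/-- A graph is chordal if every simple cycle `(v_0, …, v_{m-1}, v_0)` of length `m ≥ 4` has a
chord, i.e. two vertices `v_i`, `v_j` with `2 ≤ j - i < m - 1` that are adjacent. -/
def IsChordal {V : Type*} (G : SimpleGraph V) : Prop :=
  ∀ (v : V) (p : G.Walk v v), p.IsCycle → 4 ≤ p.length →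
    ∃ i j : ℕ, j < p.length ∧ i + 2 ≤ j ∧ j + 1 < i + p.length ∧
      G.Adj (p.getVert i) (p.getVert j)

/-- The edges of `G` together with a self-loop at each vertex. -/
def loopEdges {V : Type*} (G : SimpleGraph V) : Set (V × V) :=
  {p | p.1 = p.2 ∨ G.Adj p.1 p.2}

/-- The matrices that vanish outside the positions in `E`. -/
def withPattern {V : Type*} (E : Set (V × V)) : Set (Matrix V V ℂ) :=
  {C | ∀ i j, (i, j) ∉ E → C i j = 0}

variable {V : Type*} [Fintype V] [DecidableEq V]

/-- Phase-bounded matrices with sparsity pattern `G`. -/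
def pbConeGraph (α β : ℝ) (G : SimpleGraph V) : Set (Matrix V V ℂ) :=
  withPattern (loopEdges G) ∩ pbCone α β

/-- Partially phase-bounded matrices: the principal submatrix of every clique is
phase-bounded. -/
def partialPbCone (α β : ℝ) (G : SimpleGraph V) : Set (Matrix V V ℂ) :=
  {C | ∀ K : Finset V, G.IsClique (K : Set V) →
    C.submatrix (fun i : K => (i : V)) (fun i : K => (i : V)) ∈ pbCone α β}

/-- Completable matrices: `C` becomes phase-bounded after changing entries at positions that
are not edges of `G` (self-loops counting as edges). -/
def completableCone (α β : ℝ) (G : SimpleGraph V) : Set (Matrix V V ℂ) :=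
  {C | ∃ B ∈ withPattern (loopEdges G)ᶜ, C + B ∈ pbCone α β}

/-- Decomposable matrices: finite sums of rank-one phase-bounded matrices with sparsity
pattern `G`. The empty sum is allowed, so that the zero matrix belongs to this cone. -/
def decomposableCone (α β : ℝ) (G : SimpleGraph V) : Set (Matrix V V ℂ) :=
  {C | C ∈ withPattern (loopEdges G) ∧ ∃ (N : ℕ) (D : Fin N → Matrix V V ℂ),
    C = ∑ i, D i ∧ ∀ i, (D i).rank = 1 ∧ D i ∈ pbConeGraph α β G}

/-- The realification of a set of complex matrices through the Toeplitz decomposition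
`C = H + i S`, as a set of pairs of Hermitian matrices. -/
def realify (𝒮 : Set (Matrix V V ℂ)) :
    Set (selfAdjoint (Matrix V V ℂ) × selfAdjoint (Matrix V V ℂ)) :=
  {p | (p.1 : Matrix V V ℂ) + Complex.I • (p.2 : Matrix V V ℂ) ∈ 𝒮}

end PhaseBounded

end

/-!
Since `0 < β - α < π`, a matrix has its phases in `[α, β]` exactly when its numerical range lies in
the convex sector spanned by `e^{iα}` and `e^{iβ}`, that is, when `C = e^{iα} P + e^{iβ} Q` with
`P` and `Q` positive semidefinite (`mem_pbCone_iff`). One direction reads this off from the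
canonical form, in which no `2 × 2` block can occur; the other is the simultaneous diagonalization
of `P` and `Q` by congruence (`exists_simultaneous_diagonal`). The coefficients `P` and `Q` are
real-linear functions of `C` (`sectorPart`), compatible with principal submatrices and with
symmetric sparsity patterns, so the theorem reduces to the corresponding facts about positive
semidefinite matrices.

For a chordal graph these are proved along an elimination order of simplicial vertices
(`IsChordal.exists_isSimplicialIn`). Splitting off the column of a simplicial vertex by a Schur
complement produces a rank-one matrix supported on a clique and leaves a matrix with the same
pattern, which yields the decomposition (`IsChordal.mem_closure_vecMulVec`). Adding simplicial
vertices in the reverse order, the column of the new vertex is completed by the linear combination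
of old columns which the clique prescribes (`IsChordal.exists_posSemidef_completion`).

For a graph with a chordless cycle of length `m ≥ 4`, both equalities fail by duality. There are a
matrix `A` which is positive semidefinite of rank one on every clique, and a positive semidefinite
matrix `P` with the pattern of the graph, such that `tr (A P) < 0` (`exists_obstruction_of_cycle`):
`P` is the sum over the triangles of the fan triangulation of the cycle of rank-one matrices whose
contributions at the diagonals cancel. Then `A` has no positive semidefinite completion, and `P` is
not a sum of rank-one matrices with the same pattern, because each of these would be supported on a
clique and so pair nonnegatively with `A`.
-/

namespace PhaseBounded

open scoped ComplexOrder

/-! ### Simplicial vertices of chordal graphs -/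

section Chordal

variable {V : Type*}

/-- The graph on all of `V` whose edges are the edges of `G` with both ends in `S`. -/
def restrictTo (G : SimpleGraph V) (S : Set V) : SimpleGraph V where
  Adj a b := G.Adj a b ∧ a ∈ S ∧ b ∈ S
  symm := ⟨fun _ _ h => ⟨h.1.symm, h.2.2, h.2.1⟩⟩
  loopless := ⟨fun _ h => h.1.ne rfl⟩

lemma restrictTo_le (G : SimpleGraph V) (S : Set V) : restrictTo G S ≤ G := fun _ _ h => h.1

lemma restrictTo_mono (G : SimpleGraph V) {S T : Set V} (h : S ⊆ T) :
    restrictTo G S ≤ restrictTo G T := fun _ _ hab => ⟨hab.1, h hab.2.1, h hab.2.2⟩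

/-- A shortest walk has no shortcut: two of its vertices that are not consecutive are not
adjacent. -/
lemma not_adj_getVert_of_length_eq_dist {G : SimpleGraph V} {x y : V} (p : G.Walk x y)
    (hp : p.length = G.dist x y) {i j : ℕ} (hij : i + 2 ≤ j) (hj : j ≤ p.length) :
    ¬ G.Adj (p.getVert i) (p.getVert j) := by
  intro h
  have := SimpleGraph.dist_le ((p.take i).append (SimpleGraph.Walk.cons h (p.drop j)))
  simp [SimpleGraph.Walk.length_append, SimpleGraph.Walk.take_length,
    SimpleGraph.Walk.drop_length] at this
  omega

/-- Two neighbours of `u` that are joined by a path through vertices outside the closed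
neighbourhood of `u` are adjacent: otherwise a shortest such path closes up at `u` to a cycle
without a chord. -/
lemma IsChordal.adj_of_reachable {G : SimpleGraph V} (hG : IsChordal G) {u x y : V} {C : Set V}
    (hux : G.Adj u x) (huy : G.Adj u y) (hxy : x ≠ y) (hC : ∀ c ∈ C, c ≠ u ∧ ¬ G.Adj u c)
    (hr : (restrictTo G (insert x (insert y C))).Reachable x y) : G.Adj x y := by
  by_contra hnadj
  set S := insert x (insert y C) with hS
  obtain ⟨p, hp⟩ := hr.exists_walk_length_eq_dist
  have hpath : p.IsPath := SimpleGraph.Walk.isPath_of_length_eq_dist p hp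
  have hlen : 2 ≤ p.length := by
    by_contra hlt
    have h1 : p.length = 0 ∨ p.length = 1 := by omega
    rcases h1 with h1 | h1
    · exact hxy (SimpleGraph.Walk.eq_of_length_eq_zero h1)
    · exact hnadj (SimpleGraph.Walk.adj_of_length_eq_one h1).1
  have hmem : ∀ i ≤ p.length, p.getVert i ∈ S := by
    intro i hi
    rcases Nat.eq_zero_or_pos i with rfl | hpos
    · simp [hS]
    · have := p.adj_getVert_succ (i := i - 1) (by omega)
      rw [Nat.sub_add_cancel hpos] at this
      exact this.2.2
  have huS : u ∉ S := by
    simp only [hS, Set.mem_insert_iff, not_or]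
    exact ⟨hux.ne, huy.ne, fun h => (hC u h).1 rfl⟩
  set q := p.mapLe (restrictTo_le G S) with hq
  have hqv : ∀ i, q.getVert i = p.getVert i := fun i => by
    simp [hq, SimpleGraph.Walk.mapLe]
  have hql : q.length = p.length := by simp [hq, SimpleGraph.Walk.mapLe]
  have hqpath : q.IsPath := hpath.mapLe _
  have huq : u ∉ q.support := by
    intro h
    obtain ⟨i, hi, hi'⟩ := SimpleGraph.Walk.mem_support_iff_exists_getVert.1 h
    exact huS (hi ▸ hqv i ▸ hmem i (hql ▸ hi'))
  set c := SimpleGraph.Walk.cons hux (q.concat huy.symm) with hc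
  have hcyc : c.IsCycle := by
    rw [hc, SimpleGraph.Walk.cons_isCycle_iff]
    refine ⟨hqpath.concat huq _, ?_⟩
    rw [SimpleGraph.Walk.edges_concat, List.concat_eq_append, List.mem_append, not_or]
    refine ⟨fun h => huq (SimpleGraph.Walk.fst_mem_support_of_mem_edges _ h), ?_⟩
    simp [hux.ne', hxy]
  have hcl : c.length = p.length + 2 := by simp [hc, hql]
  have hcv : ∀ i, 1 ≤ i → i ≤ p.length + 1 → c.getVert i = p.getVert (i - 1) := by
    intro i h1 h2
    obtain ⟨i, rfl⟩ := Nat.exists_eq_add_of_le' h1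
    rw [hc, SimpleGraph.Walk.getVert_cons_succ, SimpleGraph.Walk.concat_eq_append,
      SimpleGraph.Walk.getVert_append, Nat.add_sub_cancel, ← hqv]
    split_ifs with h
    · rfl
    · have : i = q.length := by omega
      subst this
      simp
  obtain ⟨i, j, hj, hij, hji, hadj⟩ := hG u c hcyc (by omega)
  rw [hcv j (by omega) (by omega)] at hadj
  rcases Nat.eq_zero_or_pos i with rfl | hi
  · -- a chord at `u` would end at an inner vertex of the path, which lies in `C`
    rw [SimpleGraph.Walk.getVert_zero] at hadj
    have hm := hmem (j - 1) (by omega)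
    have hne0 : p.getVert (j - 1) ≠ x := fun h => by
      have := hpath.getVert_injOn (show j - 1 ≤ p.length by omega) (show 0 ≤ p.length by omega)
        (by simpa using h)
      omega
    have hne1 : p.getVert (j - 1) ≠ y := fun h => by
      have := hpath.getVert_injOn (show j - 1 ≤ p.length by omega)
        (show p.length ≤ p.length by omega) (by simpa using h)
      omega
    simp only [hS, Set.mem_insert_iff, hne0, hne1, false_or] at hm
    exact (hC _ hm).2 hadj
  · rw [hcv i hi (by omega)] at hadj
    exact not_adj_getVert_of_length_eq_dist p hp (i := i - 1) (j := j - 1) (by omega) (by omega)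
      ⟨hadj, hmem _ (by omega), hmem _ (by omega)⟩

/-- The closed neighbourhood of `v` in the subgraph induced by `W` is a clique. -/
def IsSimplicialIn (G : SimpleGraph V) (W : Set V) (v : V) : Prop :=
  G.IsClique {w | w ∈ W ∧ (w = v ∨ G.Adj v w)}

/-- A simplicial vertex exists that avoids the closed neighbourhood of any prescribed vertex `u`
which is not adjacent to all of `W`. The prescribed vertex is what makes the induction work. -/
lemma IsChordal.exists_isSimplicialIn_not_adj {G : SimpleGraph V} (hG : IsChordal G) :
    ∀ (W : Finset V) (u : V), u ∈ W → (∃ w ∈ W, w ≠ u ∧ ¬ G.Adj u w) →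
      ∃ v ∈ W, v ≠ u ∧ ¬ G.Adj u v ∧ IsSimplicialIn G W v := by
  classical
  intro W
  induction W using Finset.strongInduction with
  | H W ih =>
    rintro u huW ⟨c₀, hc₀W, hc₀u, hc₀⟩
    -- `C` is a component of the vertices outside the closed neighbourhood of `u`,
    -- and `S` is the set of neighbours of `u` attached to it
    set D : Set V := {w | w ∈ W ∧ w ≠ u ∧ ¬ G.Adj u w} with hD
    set C : Finset V := W.filter fun c => (restrictTo G D).Reachable c₀ c with hCdef
    have hCD : ∀ c ∈ C, c ∈ D := by
      intro c hc
      obtain ⟨p⟩ := (Finset.mem_filter.1 hc).2.symm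
      cases p with
      | nil => exact ⟨hc₀W, hc₀u, hc₀⟩
      | cons h _ => exact h.2.1
    have hC₀ : c₀ ∈ C := Finset.mem_filter.2 ⟨hc₀W, SimpleGraph.Reachable.refl _⟩
    have hCstep : ∀ c ∈ C, ∀ w ∈ D, G.Adj c w → w ∈ C := by
      intro c hc w hw h
      refine Finset.mem_filter.2 ⟨hw.1, (Finset.mem_filter.1 hc).2.trans ?_⟩
      exact (show (restrictTo G D).Adj c w from ⟨h, hCD c hc, hw⟩).reachable
    have hCconn : ∀ c ∈ C, (restrictTo G (C : Set V)).Reachable c₀ c := by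
      intro c hc
      have h := (Finset.mem_filter.1 hc).2
      rw [SimpleGraph.reachable_iff_reflTransGen] at h
      induction h with
      | refl => exact SimpleGraph.Reachable.refl _
      | @tail a b hab hb IH =>
        have haC : a ∈ C := Finset.mem_filter.2
          ⟨hb.2.1.1, (SimpleGraph.reachable_iff_reflTransGen _ _).2 hab⟩
        exact (IH haC).trans
          (show (restrictTo G (C : Set V)).Adj a b from ⟨hb.1, haC, hc⟩).reachable
    set S : Finset V := W.filter fun s => G.Adj u s ∧ ∃ c ∈ C, G.Adj s c with hSdef
    have hSclique : ∀ x ∈ S, ∀ y ∈ S, x ≠ y → G.Adj x y := by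
      intro x hx y hy hxy
      obtain ⟨-, hux, a, ha, hxa⟩ := Finset.mem_filter.1 hx
      obtain ⟨-, huy, b, hb, hyb⟩ := Finset.mem_filter.1 hy
      refine hG.adj_of_reachable (C := (C : Set V)) hux huy hxy (fun c hc => (hCD c hc).2) ?_
      have hsub : (C : Set V) ⊆ insert x (insert y (C : Set V)) := fun z hz => by simp_all
      have h1 : (restrictTo G (insert x (insert y (C : Set V)))).Reachable a b :=
        ((hCconn a ha).symm.trans (hCconn b hb)).mono (restrictTo_mono G hsub)
      have h2 : (restrictTo G (insert x (insert y (C : Set V)))).Adj x a :=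
        ⟨hxa, by simp, hsub ha⟩
      have h3 : (restrictTo G (insert x (insert y (C : Set V)))).Adj b y :=
        ⟨hyb.symm, hsub hb, by simp⟩
      exact h2.reachable.trans (h1.trans h3.reachable)
    -- the closed neighbourhood in `W` of a vertex of `C` lies in `C ∪ S`
    have hnbr : ∀ c ∈ C, IsSimplicialIn G ((C ∪ S : Finset V) : Set V) c →
        IsSimplicialIn G (W : Set V) c := by
      intro c hc h
      refine h.subset ?_
      rintro w ⟨hwW, hw⟩
      refine ⟨?_, hw⟩
      rw [Finset.mem_coe, Finset.mem_union]
      rcases hw with rfl | hw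
      · exact Or.inl hc
      · by_cases huw : G.Adj u w
        · exact Or.inr (Finset.mem_filter.2 ⟨hwW, huw, c, hc, hw.symm⟩)
        · refine Or.inl (hCstep c hc w ⟨hwW, ?_, huw⟩ hw)
          rintro rfl
          exact (hCD c hc).2.2 hw.symm
    suffices h : ∃ v ∈ C, IsSimplicialIn G ((C ∪ S : Finset V) : Set V) v by
      obtain ⟨v, hv, h⟩ := h
      exact ⟨v, (hCD v hv).1, (hCD v hv).2.1, (hCD v hv).2.2, hnbr v hv h⟩
    have hss : C ∪ S ⊂ W := by
      refine (Finset.ssubset_iff_of_subset ?_).2 ⟨u, huW, ?_⟩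
      · exact Finset.union_subset (Finset.filter_subset _ _) (Finset.filter_subset _ _)
      · rw [Finset.mem_union, not_or]
        exact ⟨fun h => (hCD u h).2.1 rfl, fun h => (Finset.mem_filter.1 h).2.1.ne rfl⟩
    by_cases hS : ∃ s ∈ S, ∃ w ∈ C ∪ S, w ≠ s ∧ ¬ G.Adj s w
    · obtain ⟨s, hs, hw⟩ := hS
      obtain ⟨v, hv, hvs, hnadj, hsimp⟩ := ih _ hss s (Finset.mem_union_right _ hs) hw
      refine ⟨v, (Finset.mem_union.1 hv).resolve_right fun hvS => ?_, hsimp⟩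
      exact hnadj (hSclique s hs v hvS hvs.symm)
    · push Not at hS
      by_cases hC : ∃ x ∈ C, ∃ w ∈ C ∪ S, w ≠ x ∧ ¬ G.Adj x w
      · obtain ⟨x, hx, hw⟩ := hC
        obtain ⟨v, hv, hvx, hnadj, hsimp⟩ := ih _ hss x (Finset.mem_union_left _ hx) hw
        refine ⟨v, (Finset.mem_union.1 hv).resolve_right fun hvS => ?_, hsimp⟩
        exact hnadj (hS v hvS x (Finset.mem_union_left _ hx) hvx.symm).symm
      · push Not at hC
        refine ⟨c₀, hC₀, ?_⟩
        rintro a ⟨ha, -⟩ b ⟨hb, -⟩ hab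
        rcases Finset.mem_union.1 ha with ha | ha
        · exact hC a ha b hb hab.symm
        · exact hS a ha b hb hab.symm

/-- **Dirac's theorem**: every nonempty induced subgraph of a chordal graph has a simplicial
vertex. -/
lemma IsChordal.exists_isSimplicialIn {G : SimpleGraph V} (hG : IsChordal G) (W : Finset V)
    (hW : W.Nonempty) : ∃ v ∈ W, IsSimplicialIn G (W : Set V) v := by
  by_cases h : ∃ u ∈ W, ∃ w ∈ W, w ≠ u ∧ ¬ G.Adj u w
  · obtain ⟨u, hu, hw⟩ := h
    obtain ⟨v, hv, -, -, hs⟩ := hG.exists_isSimplicialIn_not_adj W u hu hw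
    exact ⟨v, hv, hs⟩
  · push Not at h
    obtain ⟨v, hv⟩ := hW
    exact ⟨v, hv, fun a ha b hb hab => h a ha.1 b hb.1 hab.symm⟩

end Chordal

/-! ### Positive semidefinite matrices with a chordal pattern -/

section PosSemidef

variable {n : Type*} [Fintype n] [DecidableEq n]

lemma posSemidef_apply_eq_zero_right {A : Matrix n n ℂ} (hA : A.PosSemidef) {j : n}
    (h : A j j = 0) (i : n) : A i j = 0 := by
  have := (hA.dotProduct_mulVec_zero_iff (Pi.single j 1)).1 (by simp [h])
  simpa using congrFun this i

lemma posSemidef_apply_eq_zero_left {A : Matrix n n ℂ} (hA : A.PosSemidef) {i : n}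
    (h : A i i = 0) (j : n) : A i j = 0 := by
  rw [← hA.1.apply, posSemidef_apply_eq_zero_right hA h, star_zero]

/-- A column of a positive semidefinite matrix is a combination of the other columns off the
diagonal, with a nonnegative remainder on the diagonal: in a Gram representation, project one
vector onto the span of the others. -/
lemma exists_column_eq_mulVec {N : Matrix n n ℂ} (hN : N.PosSemidef) (v : n) :
    ∃ (y : n → ℂ) (c : ℂ), y v = 0 ∧ 0 ≤ c ∧ (∀ s, s ≠ v → N s v = (N *ᵥ y) s) ∧
      N v v = star y ⬝ᵥ (N *ᵥ y) + c := by
  obtain ⟨B, hB⟩ : ∃ B : Matrix n n ℂ, N = Bᴴ * B := by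
    open scoped MatrixOrder Matrix.Norms.L2Operator in
    exact CStarAlgebra.nonneg_iff_eq_star_mul_self.mp hN.nonneg
  set x : n → EuclideanSpace ℂ n := fun i => WithLp.toLp 2 fun k => B k i with hx
  have hin : ∀ i j, inner ℂ (x i) (x j) = N i j := by
    intro i j
    simp [hx, hB, PiLp.inner_apply, Matrix.mul_apply, mul_comm]
  set z : n → EuclideanSpace ℂ n := fun t => if t = v then 0 else x t with hz
  set U := Submodule.span ℂ (Set.range z) with hU
  obtain ⟨p, hp, r, hr, hpr⟩ := U.exists_add_mem_mem_orthogonal (x v)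
  obtain ⟨c, hc⟩ := (Submodule.mem_span_range_iff_exists_fun ℂ).1 hp
  set y : n → ℂ := fun t => if t = v then 0 else c t with hy
  have hpy : p = ∑ t, y t • x t := by
    rw [← hc]
    refine Finset.sum_congr rfl fun t _ => ?_
    by_cases h : t = v <;> simp [hz, hy, h]
  have hpx : ∀ s, inner ℂ (x s) p = (N *ᵥ y) s := by
    intro s
    simp [hpy, hin, mulVec, dotProduct, mul_comm]
  refine ⟨y, inner ℂ r r, by simp [hy], ?_, fun s hs => ?_, ?_⟩
  · simp [inner_self_eq_norm_sq_to_K]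
  · have : inner ℂ (x s) r = 0 :=
      hr _ (Submodule.subset_span ⟨s, by simp [hz, hs]⟩)
    rw [← hin, hpr, inner_add_right, this, add_zero, hpx]
  · have h1 : inner ℂ p r = 0 := hr _ hp
    have h2 : inner ℂ r p = 0 := by rw [← inner_conj_symm, h1, map_zero]
    have h3 : inner ℂ p p = star y ⬝ᵥ (N *ᵥ y) := by
      nth_rw 1 [hpy]
      simp [hpx, dotProduct, mul_comm]
    rw [← hin, hpr, inner_add_left, inner_add_right, inner_add_right, h1, h2, h3]
    ring

/-- Splitting off one column of a positive semidefinite matrix with a rank-one matrix leaves a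
positive semidefinite matrix, the Schur complement. -/
lemma exists_posSemidef_sub_vecMulVec {P : Matrix n n ℂ} (hP : P.PosSemidef) {v : n}
    (hv : P v v ≠ 0) :
    ∃ x : n → ℂ, (∀ i, x i = 0 ↔ P i v = 0) ∧ (∀ i, x i * star (x v) = P i v) ∧
      (P - vecMulVec x (star x)).PosSemidef := by
  set d := P v v with hd
  have hd0 : 0 ≤ d := hP.diag_nonneg
  obtain ⟨r, hr0, hr⟩ : ∃ r : ℝ, r ≠ 0 ∧ (r : ℂ) * r = d := by
    obtain ⟨h1, h2⟩ := Complex.le_def.1 hd0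
    have hre : d = (d.re : ℂ) := Complex.ext (by simp) (by simpa using h2.symm)
    have hpos : 0 < d.re := lt_of_le_of_ne h1 fun h => hv (by rw [hre, ← h]; simp)
    refine ⟨√d.re, (Real.sqrt_pos.2 hpos).ne', ?_⟩
    rw [← Complex.ofReal_mul, Real.mul_self_sqrt hpos.le, ← hre]
  have hrc : (r : ℂ) ≠ 0 := by exact_mod_cast hr0
  have hstar : ∀ i j, star (P i j) = P j i := fun i j => hP.1.apply j i
  refine ⟨fun i => P i v / r, fun i => by simp [hr0], fun i => ?_, ?_⟩
  · rw [star_div₀, hstar, ← hd, ← hr, Complex.star_def, Complex.conj_ofReal]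
    field_simp
  -- the Schur complement `S` is obtained from `P` by the congruence with `J`
  · set J : Matrix n n ℂ := 1 - vecMulVec (Pi.single v 1) (fun j => d⁻¹ * P v j) with hJ
    set S : Matrix n n ℂ := P - vecMulVec (fun i => P i v) (fun j => d⁻¹ * P v j) with hS
    have h1 : P * J = S := by
      rw [hJ, hS, mul_sub, mul_one, mul_vecMulVec]
      congr 2
      ext i
      simp
    have h2 : Pi.single v 1 ᵥ* S = 0 := by
      ext j
      simp [hS, vecMulVec_apply, ← hd, hv]
    have h3 : Jᴴ * S = S := by
      rw [hJ, conjTranspose_sub, conjTranspose_one, conjTranspose_vecMulVec, sub_mul, one_mul,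
        vecMulVec_mul, ← Pi.single_star, star_one, h2]
      simp
    have h4 : P - vecMulVec (fun i => P i v / r) (star fun i => P i v / r) = S := by
      ext i j
      simp only [hS, Matrix.sub_apply, vecMulVec_apply, Pi.star_apply, star_div₀, hstar,
        Complex.star_def, Complex.conj_ofReal, ← hr]
      field_simp
    rw [h4, ← h3, ← h1, ← mul_assoc]
    exact hP.conjTranspose_mul_mul_same J

end PosSemidef

section Pattern

variable {V : Type*} [Fintype V] [DecidableEq V]

lemma loopEdges_symm {V : Type*} {G : SimpleGraph V} {i j : V} (h : (i, j) ∈ loopEdges G) :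
    (j, i) ∈ loopEdges G :=
  h.imp Eq.symm SimpleGraph.Adj.symm

/-- A positive semidefinite matrix with a chordal pattern is a sum of positive semidefinite
matrices of rank at most one with the same pattern: eliminate simplicial vertices. -/
lemma IsChordal.mem_closure_vecMulVec {G : SimpleGraph V} (hG : IsChordal G) {P : Matrix V V ℂ}
    (hP : P.PosSemidef) (hE : P ∈ withPattern (loopEdges G)) :
    P ∈ AddSubmonoid.closure {M : Matrix V V ℂ | ∃ x : V → ℂ, M = vecMulVec x (star x) ∧
      M ∈ withPattern (loopEdges G)} := by
  suffices h : ∀ (W : Finset V) (P : Matrix V V ℂ), P.PosSemidef →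
      P ∈ withPattern (loopEdges G) → (∀ i ∉ W, P i i = 0) →
      P ∈ AddSubmonoid.closure {M : Matrix V V ℂ | ∃ x : V → ℂ, M = vecMulVec x (star x) ∧
        M ∈ withPattern (loopEdges G)} from h Finset.univ P hP hE (by simp)
  intro W
  induction W using Finset.strongInduction with
  | H W ih =>
    intro P hP hE hW
    rcases W.eq_empty_or_nonempty with rfl | hne
    · have : P = 0 := by
        ext i j
        exact posSemidef_apply_eq_zero_left hP (hW i (by simp)) j
      rw [this]
      exact zero_mem _
    obtain ⟨v, hvW, hv⟩ := hG.exists_isSimplicialIn W hne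
    by_cases hd : P v v = 0
    · refine ih _ (Finset.erase_ssubset hvW) P hP hE fun i hi => ?_
      by_cases hiv : i = v
      · rw [hiv, hd]
      · exact hW i fun h => hi (Finset.mem_erase.2 ⟨hiv, h⟩)
    obtain ⟨x, hx0, hxv, hx⟩ := exists_posSemidef_sub_vecMulVec hP hd
    have hxE : vecMulVec x (star x) ∈ withPattern (loopEdges G) := by
      -- the support of `x` lies in the closed neighbourhood of `v` in `W`, a clique
      have hsupp : ∀ i, x i ≠ 0 → i ∈ {w | w ∈ (W : Set V) ∧ (w = v ∨ G.Adj v w)} := by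
        intro i hi
        rw [Ne, hx0] at hi
        refine ⟨?_, ?_⟩
        · by_contra h
          exact hi (posSemidef_apply_eq_zero_left hP (hW i h) v)
        · by_contra h
          exact hi (hE i v fun h' => h (h'.imp_right SimpleGraph.Adj.symm))
      intro i j hij
      by_contra h
      rw [vecMulVec_apply, Pi.star_apply, mul_eq_zero, star_eq_zero, not_or] at h
      by_cases hne : i = j
      · exact hij (Or.inl hne)
      · exact hij (Or.inr (hv (hsupp i h.1) (hsupp j h.2) hne))
    rw [← sub_add_cancel P (vecMulVec x (star x))]
    refine add_mem (ih _ (Finset.erase_ssubset hvW) _ hx ?_ ?_)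
      (AddSubmonoid.subset_closure ⟨x, rfl, hxE⟩)
    · intro i j hij
      rw [Matrix.sub_apply, hE i j hij, hxE i j hij, sub_zero]
    · intro i hi
      by_cases hiv : i = v
      · rw [hiv, Matrix.sub_apply, vecMulVec_apply, Pi.star_apply, hxv, sub_self]
      · have h0 := hW i fun h => hi (Finset.mem_erase.2 ⟨hiv, h⟩)
        have : x i = 0 := (hx0 i).2 (posSemidef_apply_eq_zero_left hP h0 v)
        simp [h0, this, vecMulVec_apply]

/-- A positive semidefinite principal submatrix, extended by zero, is positive semidefinite. -/
lemma posSemidef_extend_zero {A : Matrix V V ℂ} (K : Finset V)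
    (hA : (A.submatrix (fun i : K => (i : V)) (fun i : K => (i : V))).PosSemidef) :
    (Matrix.of fun i j => if i ∈ K ∧ j ∈ K then A i j else 0).PosSemidef := by
  have h := hA.conjTranspose_mul_mul_same
    (Matrix.of fun (k : K) (j : V) => if (k : V) = j then (1 : ℂ) else 0)
  convert h using 1
  ext i j
  simp only [of_apply, mul_apply, conjTranspose_apply, submatrix_apply]
  rw [Finset.sum_coe_sort K
    (fun l => (∑ k : K, star (if (k : V) = i then (1 : ℂ) else 0) * A k l) *
      if l = j then (1 : ℂ) else 0)]
  simp_rw [fun l => Finset.sum_coe_sort K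
    (fun k => star (if k = i then (1 : ℂ) else 0) * A k l)]
  by_cases hi : i ∈ K <;> by_cases hj : j ∈ K <;>
    simp [hi, hj, apply_ite (star : ℂ → ℂ), ite_mul]

/-- A Hermitian matrix whose principal submatrices on the cliques of a chordal graph are
positive semidefinite agrees on the edges with a positive semidefinite matrix: add simplicial
vertices one at a time, completing the new column by the linear combination of the old ones
which the clique prescribes. -/
lemma IsChordal.exists_posSemidef_completion {G : SimpleGraph V} (hG : IsChordal G)
    {A : Matrix V V ℂ} (hA : ∀ K : Finset V, G.IsClique (K : Set V) →
      (A.submatrix (fun i : K => (i : V)) (fun i : K => (i : V))).PosSemidef) :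
    ∃ M : Matrix V V ℂ, M.PosSemidef ∧ ∀ i j, (i, j) ∈ loopEdges G → M i j = A i j := by
  suffices h : ∀ W : Finset V, ∃ M : Matrix V V ℂ, M.PosSemidef ∧
      ∀ i ∈ W, ∀ j ∈ W, (i, j) ∈ loopEdges G → M i j = A i j by
    obtain ⟨M, hM, h⟩ := h Finset.univ
    exact ⟨M, hM, fun i j => h i (by simp) j (by simp)⟩
  classical
  intro W
  induction W using Finset.strongInduction with
  | H W ih =>
    rcases W.eq_empty_or_nonempty with rfl | hne
    · exact ⟨0, PosSemidef.zero, by simp⟩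
    obtain ⟨v, hvW, hv⟩ := hG.exists_isSimplicialIn W hne
    obtain ⟨M, hM, hMA⟩ := ih _ (Finset.erase_ssubset hvW)
    set K : Finset V := W.filter fun w => w = v ∨ G.Adj v w with hK
    have hKcl : G.IsClique (K : Set V) := by
      simpa [hK, IsSimplicialIn, Finset.coe_filter] using hv
    have hvK : v ∈ K := by simp [hK, hvW]
    have hKE : ∀ i ∈ K, ∀ j ∈ K, (i, j) ∈ loopEdges G := by
      intro i hi j hj
      by_cases h : i = j
      · exact Or.inl h
      · exact Or.inr (hKcl hi hj h)
    obtain ⟨y, c, hyv, hc, hcol, hdiag⟩ :=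
      exists_column_eq_mulVec (posSemidef_extend_zero K (hA K hKcl)) v
    -- only the coefficients in the clique matter
    set u : V → ℂ := fun t => if t ∈ K then y t else 0 with hu
    have huv : u v = 0 := by simp [hu, hyv]
    have hMu : ∀ s ∈ K, s ≠ v → (M *ᵥ u) s = ∑ t ∈ K, A s t * y t := by
      intro s hs hsv
      simp only [mulVec, dotProduct, hu, mul_ite, mul_zero, Finset.sum_ite_mem,
        Finset.univ_inter]
      refine Finset.sum_congr rfl fun t ht => ?_
      by_cases htv : t = v
      · simp [htv, hyv]
      · rw [hMA s (Finset.mem_erase.2 ⟨hsv, (Finset.mem_filter.1 hs).1⟩) t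
          (Finset.mem_erase.2 ⟨htv, (Finset.mem_filter.1 ht).1⟩) (hKE s hs t ht)]
    have hNy : ∀ s ∈ K, ((Matrix.of fun i j => if i ∈ K ∧ j ∈ K then A i j else 0) *ᵥ y) s =
        ∑ t ∈ K, A s t * y t := by
      intro s hs
      simp [mulVec, dotProduct, hs, ite_mul, Finset.sum_ite_mem]
    have hcol' : ∀ s ∈ K, s ≠ v → (M *ᵥ u) s = A s v := by
      intro s hs hsv
      have := hcol s hsv
      rw [hNy s hs] at this
      rw [hMu s hs hsv, ← this]
      simp [hs, hvK]
    have hdiag' : star u ⬝ᵥ (M *ᵥ u) + c = A v v := by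
      rw [of_apply, if_pos ⟨hvK, hvK⟩] at hdiag
      rw [hdiag]
      congr 1
      simp only [dotProduct]
      refine Finset.sum_congr rfl fun s _ => ?_
      by_cases hsv : s = v
      · simp [hsv, hyv, huv]
      by_cases hs : s ∈ K
      · rw [hMu s hs hsv, hNy s hs]
        simp [hu, hs]
      · simp [hu, hs, mulVec, dotProduct]
    -- the congruence by `J` keeps `M` off `v` and makes column `v` equal to `M *ᵥ u`
    set J : Matrix V V ℂ := (1 : Matrix V V ℂ).updateRow v (star u) with hJ
    have hJv : J v = star u := by simp [hJ]
    have hJi : ∀ i, i ≠ v → J i = Pi.single i 1 := by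
      intro i hi
      rw [hJ, updateRow_ne hi]
      ext j
      simp [one_apply, Pi.single_apply, eq_comm]
    have hent : ∀ i j, (J * M * Jᴴ) i j = J i ⬝ᵥ (M *ᵥ star (J j)) := by
      intro i j
      rw [mul_assoc, mul_apply]
      simp [dotProduct, mul_apply, mulVec]
    have hMadd : (J * M * Jᴴ + Matrix.single v v c).PosSemidef := by
      refine (hM.mul_mul_conjTranspose_same J).add ?_
      rw [← diagonal_single]
      exact PosSemidef.diagonal fun i => by
        by_cases h : i = v
        · subst h; simpa using hc
        · simp [h]
    refine ⟨_, hMadd, ?_⟩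
    have hcolv : ∀ i ∈ W, i ≠ v → (i, v) ∈ loopEdges G → (J * M * Jᴴ) i v = A i v := by
      intro i hi hiv hE
      have hiK : i ∈ K := by
        refine Finset.mem_filter.2 ⟨hi, Or.inr ?_⟩
        exact (hE.resolve_left hiv).symm
      rw [hent, hJv, star_star, hJi i hiv, single_one_dotProduct, hcol' i hiK hiv]
    intro i hi j hj hE
    by_cases hiv : i = v
    · by_cases hjv : j = v
      · subst hiv; subst hjv
        rw [Matrix.add_apply, hent, hJv, star_star, single_apply_same, hdiag']
      · subst hiv
        rw [← hMadd.1.apply, Matrix.add_apply, hcolv j hj hjv (loopEdges_symm hE),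
          single_apply_of_ne _ _ _ _ _ (by tauto), add_zero]
        -- the prescribed entries are Hermitian because the clique `{i, j}` is
        have hjK : j ∈ K := Finset.mem_filter.2
          ⟨hj, Or.inr (hE.resolve_left fun h => hjv h.symm)⟩
        exact (hA K hKcl).1.apply (⟨i, hvK⟩ : K) ⟨j, hjK⟩
    · rw [Matrix.add_apply, single_apply_of_ne _ _ _ _ _ (by tauto), add_zero]
      by_cases hjv : j = v
      · subst hjv
        exact hcolv i hi hiv hE
      · rw [hent, hJi i hiv, hJi j hjv, ← Pi.single_star, star_one, single_one_dotProduct]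
        rw [mulVec_single_one]
        exact hMA i (Finset.mem_erase.2 ⟨hiv, hi⟩) j (Finset.mem_erase.2 ⟨hjv, hj⟩) hE

end Pattern

/-! ### Phase-bounded matrices as pairs of positive semidefinite matrices -/

section Trigonometry

/-- The point of the unit circle with argument `θ`. -/
noncomputable def unitPhase (θ : ℝ) : ℂ := Complex.exp (Complex.I * (θ : ℂ))

lemma unitPhase_eq (θ : ℝ) : unitPhase θ = Real.cos θ + Real.sin θ * Complex.I := by
  rw [unitPhase, mul_comm, Complex.exp_mul_I]
  push_cast
  rfl

lemma star_unitPhase (θ : ℝ) : star (unitPhase θ) = unitPhase (-θ) := by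
  simp [unitPhase_eq, -Complex.ofReal_cos, -Complex.ofReal_sin]

lemma unitPhase_mul_neg (θ : ℝ) : unitPhase θ * unitPhase (-θ) = 1 := by
  simp [unitPhase, ← Complex.exp_add]

lemma unitPhase_mul_sub (θ ψ : ℝ) :
    unitPhase (-ψ) * unitPhase θ - unitPhase ψ * unitPhase (-θ) =
      -(2 * Real.sin (ψ - θ) * Complex.I) := by
  rw [Real.sin_sub]
  simp only [unitPhase_eq, Real.cos_neg, Real.sin_neg]
  push_cast
  ring

/-- A point of the unit circle as a combination of the points with arguments `α` and `β`. -/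
lemma sin_smul_unitPhase (α β a : ℝ) :
    (Real.sin (β - α) : ℂ) * unitPhase a =
      Real.sin (β - a) * unitPhase α + Real.sin (a - α) * unitPhase β := by
  simp only [unitPhase_eq, Real.sin_sub]
  push_cast
  ring

/-- A nonzero point of the sector spanned by `unitPhase α` and `unitPhase β` has an argument
in `[α, β]`. -/
lemma exists_unitPhase_eq {α β : ℝ} (hpos : 0 < β - α) (hlt : β - α < Real.pi) {p q : ℝ}
    (hp : 0 ≤ p) (hq : 0 ≤ q) (h : p ≠ 0 ∨ q ≠ 0) :
    ∃ r a : ℝ, 0 < r ∧ α ≤ a ∧ a ≤ β ∧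
      (p : ℂ) * unitPhase α + q * unitPhase β = r * unitPhase a := by
  have hs : 0 < Real.sin (β - α) := Real.sin_pos_of_pos_of_lt_pi hpos hlt
  -- rotate until the imaginary part vanishes
  obtain ⟨a, ⟨ha1, ha2⟩, ha⟩ : ∃ a ∈ Set.Icc α β,
      p * Real.sin (a - α) - q * Real.sin (β - a) = 0 := by
    have hc : ContinuousOn (fun a => p * Real.sin (a - α) - q * Real.sin (β - a))
        (Set.Icc α β) := by fun_prop
    refine intermediate_value_Icc (by linarith) hc ⟨?_, ?_⟩
    · simpa using mul_nonneg hq hs.le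
    · simpa using mul_nonneg hp hs.le
  have h1 : 0 ≤ Real.sin (a - α) :=
    Real.sin_nonneg_of_nonneg_of_le_pi (by linarith) (by linarith)
  have h2 : 0 ≤ Real.sin (β - a) :=
    Real.sin_nonneg_of_nonneg_of_le_pi (by linarith) (by linarith)
  set r := p * Real.cos (a - α) + q * Real.cos (β - a) with hr
  have hsin : Real.sin (β - α) =
      Real.sin (β - a) * Real.cos (a - α) + Real.cos (β - a) * Real.sin (a - α) := by
    rw [← Real.sin_add]
    congr 1
    ring
  have hrp : r * Real.sin (β - a) = p * Real.sin (β - α) := by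
    rw [hr, hsin]
    linear_combination - Real.cos (β - a) * ha
  have hrq : r * Real.sin (a - α) = q * Real.sin (β - α) := by
    rw [hr, hsin]
    linear_combination Real.cos (a - α) * ha
  have hrpos : 0 < r := by
    by_contra hle
    push Not at hle
    rcases h with h | h
    · have := mul_pos (lt_of_le_of_ne hp h.symm) hs
      nlinarith
    · have := mul_pos (lt_of_le_of_ne hq h.symm) hs
      nlinarith
  refine ⟨r, a, hrpos, ha1, ha2, ?_⟩
  have hsc : (Real.sin (β - α) : ℂ) ≠ 0 := by exact_mod_cast hs.ne'
  refine mul_left_cancel₀ hsc ?_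
  have hrp' : (r : ℂ) * Real.sin (β - a) = p * Real.sin (β - α) := by exact_mod_cast hrp
  have hrq' : (r : ℂ) * Real.sin (a - α) = q * Real.sin (β - α) := by exact_mod_cast hrq
  have := sin_smul_unitPhase α β a
  linear_combination (-(r : ℂ)) * this - unitPhase α * hrp' - unitPhase β * hrq'

end Trigonometry

section SectorPart

variable {n : Type*}

/-- For Hermitian `P` and `Q`, the coefficient `P` of a matrix `e^{iθ} P + e^{iψ} Q`. -/
noncomputable def sectorPart (θ ψ : ℝ) (C : Matrix n n ℂ) : Matrix n n ℂ :=
  (Complex.I / (2 * Real.sin (ψ - θ))) • (unitPhase (-ψ) • C - unitPhase ψ • Cᴴ)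

lemma sectorPart_apply (θ ψ : ℝ) (C : Matrix n n ℂ) (i j : n) :
    sectorPart θ ψ C i j = Complex.I / (2 * Real.sin (ψ - θ)) *
      (unitPhase (-ψ) * C i j - unitPhase ψ * star (C j i)) := by
  simp [sectorPart]

lemma sectorPart_submatrix {m : Type*} (θ ψ : ℝ) (C : Matrix n n ℂ) (f : m → n) :
    sectorPart θ ψ (C.submatrix f f) = (sectorPart θ ψ C).submatrix f f := by
  ext i j
  simp [sectorPart_apply]

lemma sectorPart_zero (θ ψ : ℝ) : sectorPart θ ψ (0 : Matrix n n ℂ) = 0 := by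
  ext i j
  simp [sectorPart_apply]

lemma sectorPart_add (θ ψ : ℝ) (C D : Matrix n n ℂ) :
    sectorPart θ ψ (C + D) = sectorPart θ ψ C + sectorPart θ ψ D := by
  ext i j
  simp only [sectorPart_apply, Matrix.add_apply, star_add]
  ring

lemma sectorPart_sum {ι : Type*} (s : Finset ι) (θ ψ : ℝ) (D : ι → Matrix n n ℂ) :
    sectorPart θ ψ (∑ i ∈ s, D i) = ∑ i ∈ s, sectorPart θ ψ (D i) :=
  map_sum (AddMonoidHom.mk' (sectorPart θ ψ) (sectorPart_add θ ψ)) D s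

lemma sectorPart_mem_withPattern {V : Type*} {G : SimpleGraph V} {C : Matrix V V ℂ}
    (hC : C ∈ withPattern (loopEdges G)) (θ ψ : ℝ) :
    sectorPart θ ψ C ∈ withPattern (loopEdges G) := by
  intro i j hij
  simp [sectorPart_apply, hC i j hij, hC j i fun h => hij (loopEdges_symm h)]

/-- The coefficient can be recovered because `C` and its adjoint determine `P` and `Q` as the
solution of a linear system with determinant `2 i sin (ψ - θ)`, up to sign. -/
lemma sectorPart_combine {θ ψ : ℝ} (h : Real.sin (ψ - θ) ≠ 0) {P Q : Matrix n n ℂ}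
    (hP : P.IsHermitian) (hQ : Q.IsHermitian) :
    sectorPart θ ψ (unitPhase θ • P + unitPhase ψ • Q) = P := by
  have hs : (Real.sin (ψ - θ) : ℂ) ≠ 0 := by exact_mod_cast h
  ext i j
  have h1 := unitPhase_mul_sub θ ψ
  simp only [sectorPart_apply, Matrix.add_apply, Matrix.smul_apply, smul_eq_mul, star_add, star_mul',
    hP.apply, hQ.apply, star_unitPhase]
  have h3 : unitPhase (-ψ) * (unitPhase θ * P i j + unitPhase ψ * Q i j) -
      unitPhase ψ * (unitPhase (-θ) * P i j + unitPhase (-ψ) * Q i j) =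
      -(2 * Real.sin (ψ - θ) * Complex.I) * P i j := by
    linear_combination P i j * h1
  rw [h3]
  field_simp
  linear_combination (-P i j) * Complex.I_sq

lemma sectorPart_combine' {θ ψ : ℝ} (h : Real.sin (ψ - θ) ≠ 0) {P Q : Matrix n n ℂ}
    (hP : P.IsHermitian) (hQ : Q.IsHermitian) :
    sectorPart ψ θ (unitPhase θ • P + unitPhase ψ • Q) = Q := by
  rw [add_comm]
  exact sectorPart_combine (by rwa [← neg_sub, Real.sin_neg, neg_ne_zero]) hQ hP

lemma eq_sectorPart_combine {θ ψ : ℝ} (h : Real.sin (ψ - θ) ≠ 0) (C : Matrix n n ℂ) :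
    C = unitPhase θ • sectorPart θ ψ C + unitPhase ψ • sectorPart ψ θ C := by
  have hs : (Real.sin (ψ - θ) : ℂ) ≠ 0 := by exact_mod_cast h
  ext i j
  have h1 := unitPhase_mul_sub θ ψ
  have hneg : Real.sin (θ - ψ) = - Real.sin (ψ - θ) := by rw [← neg_sub, Real.sin_neg]
  simp only [sectorPart_apply, Matrix.add_apply, Matrix.smul_apply, smul_eq_mul, hneg]
  push_cast
  have hs' : Complex.sin (ψ - θ) ≠ 0 := by exact_mod_cast hs
  push_cast at h1
  field_simp
  linear_combination (-Complex.I * C i j) * h1 + 2 * C i j * Complex.sin (ψ - θ) * Complex.I_sq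

end SectorPart

section Characterization

variable {n : Type*} [Fintype n] [DecidableEq n]

/-- A positive semidefinite matrix is congruent to a diagonal matrix with entries `0` and `1`. -/
lemma exists_eq_congr_diagonal {S : Matrix n n ℂ} (hS : S.PosSemidef) :
    ∃ (W : Matrix n n ℂ) (ε : n → ℂ), IsUnit W ∧ (∀ i, ε i = 0 ∨ ε i = 1) ∧
      S = W * diagonal ε * Wᴴ := by
  set U := (hS.1.eigenvectorUnitary : Matrix n n ℂ) with hU
  have hUU : U * Uᴴ = 1 := Unitary.coe_mul_star_self hS.1.eigenvectorUnitary
  have hsp : S = U * diagonal (fun i => (hS.1.eigenvalues i : ℂ)) * Uᴴ := by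
    conv_lhs => rw [hS.1.spectral_theorem, Unitary.conjStarAlgAut_apply]
    rfl
  set lam := hS.1.eigenvalues with hlam
  have hnn : ∀ i, 0 ≤ lam i := hS.eigenvalues_nonneg
  set w : n → ℂ := fun i => if lam i = 0 then 1 else (√(lam i) : ℝ) with hw
  have hw0 : ∀ i, w i ≠ 0 := by
    intro i
    by_cases h : lam i = 0
    · simp [hw, h]
    · simp [hw, h, Real.sqrt_eq_zero (hnn i)]
  refine ⟨U * diagonal w, fun i => if lam i = 0 then 0 else 1, ?_, ?_, ?_⟩
  · refine (IsUnit.of_mul_eq_one _ hUU).mul ?_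
    rw [isUnit_diagonal, Pi.isUnit_iff]
    exact fun i => (hw0 i).isUnit
  · intro i
    by_cases h : lam i = 0 <;> simp [h]
  · rw [hsp, conjTranspose_mul, diagonal_conjTranspose]
    have : diagonal (fun i => (lam i : ℂ)) =
        diagonal w * diagonal (fun i => if lam i = 0 then (0 : ℂ) else 1) *
          diagonal (star w) := by
      rw [diagonal_mul_diagonal, diagonal_mul_diagonal]
      congr 1
      ext i
      by_cases h : lam i = 0
      · simp [h]
      · simp [hw, h, ← Complex.ofReal_mul, Real.mul_self_sqrt (hnn i)]
    rw [this]
    simp only [mul_assoc]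

/-- Two positive semidefinite matrices are simultaneously diagonalizable by congruence. -/
lemma exists_simultaneous_diagonal {P Q : Matrix n n ℂ} (hP : P.PosSemidef)
    (hQ : Q.PosSemidef) :
    ∃ (T : Matrix n n ℂ) (p q : n → ℝ), IsUnit T ∧ (∀ i, 0 ≤ p i) ∧ (∀ i, 0 ≤ q i) ∧
      P = T * diagonal (fun i => (p i : ℂ)) * Tᴴ ∧
      Q = T * diagonal (fun i => (q i : ℂ)) * Tᴴ := by
  obtain ⟨W, ε, hW, hε, hS⟩ := exists_eq_congr_diagonal (hP.add hQ)
  obtain ⟨W', hW'W, hWW'⟩ : ∃ W', W' * W = 1 ∧ W * W' = 1 := by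
    obtain ⟨u, rfl⟩ := hW
    exact ⟨↑u⁻¹, u.inv_mul, u.mul_inv⟩
  have hWWc : W'ᴴ * Wᴴ = 1 := by rw [← conjTranspose_mul, hWW', conjTranspose_one]
  have hWWc' : Wᴴ * W'ᴴ = 1 := by rw [← conjTranspose_mul, hW'W, conjTranspose_one]
  have hback : ∀ A : Matrix n n ℂ, W * (W' * A * W'ᴴ) * Wᴴ = A := fun A => by
    calc W * (W' * A * W'ᴴ) * Wᴴ = (W * W') * A * (W'ᴴ * Wᴴ) := by simp only [mul_assoc]
      _ = A := by rw [hWW', hWWc, one_mul, mul_one]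
  -- after the congruence `W'`, the sum of the two matrices is the projection `diagonal ε`
  set P₁ := W' * P * W'ᴴ with hP₁
  set Q₁ := W' * Q * W'ᴴ with hQ₁
  have hP₁p : P₁.PosSemidef := hP.mul_mul_conjTranspose_same W'
  have hQ₁p : Q₁.PosSemidef := hQ.mul_mul_conjTranspose_same W'
  have hsum : P₁ + Q₁ = diagonal ε := by
    rw [hP₁, hQ₁, ← add_mul, ← mul_add, hS]
    calc W' * (W * diagonal ε * Wᴴ) * W'ᴴ = (W' * W) * diagonal ε * (Wᴴ * W'ᴴ) := by
          simp only [mul_assoc]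
      _ = diagonal ε := by rw [hW'W, hWWc', one_mul, mul_one]
  have hεP : diagonal ε * P₁ = P₁ := by
    ext i j
    rw [diagonal_mul]
    rcases hε i with h | h
    · have h1 : P₁ i i + Q₁ i i = 0 := by
        rw [← Matrix.add_apply, hsum, diagonal_apply_eq, h]
      have h2 : P₁ i i = 0 :=
        le_antisymm (by rw [eq_neg_of_add_eq_zero_left h1]; simpa using hQ₁p.diag_nonneg)
          hP₁p.diag_nonneg
      rw [posSemidef_apply_eq_zero_left hP₁p h2, mul_zero]
    · rw [h, one_mul]
  have hεε : diagonal ε * diagonal ε = diagonal ε := by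
    rw [diagonal_mul_diagonal]
    congr 1
    ext i
    rcases hε i with h | h <;> simp [h]
  have hεp : (diagonal ε).PosSemidef := hsum ▸ hP₁p.add hQ₁p
  -- shifting the common kernel to the eigenvalue `-1` separates it from the kernel of `P₁`,
  -- so that an eigenbasis of `M` diagonalizes the projection as well
  set M := P₁ - (1 - diagonal ε) with hM
  have hMh : M.IsHermitian := hP₁p.1.sub (isHermitian_one.sub hεp.1)
  set U := (hMh.eigenvectorUnitary : Matrix n n ℂ) with hU
  have hUU : U * Uᴴ = 1 := Unitary.coe_mul_star_self hMh.eigenvectorUnitary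
  have hUU' : Uᴴ * U = 1 := Unitary.coe_star_mul_self hMh.eigenvectorUnitary
  set r : n → ℂ := fun i => (hMh.eigenvalues i : ℂ) with hr
  have hsp : M = U * diagonal r * Uᴴ := by
    conv_lhs => rw [hMh.spectral_theorem, Unitary.conjStarAlgAut_apply]
    rfl
  set X := Uᴴ * diagonal ε * U with hX
  set Y := Uᴴ * P₁ * U with hY
  have hXp : X.PosSemidef := hεp.conjTranspose_mul_mul_same U
  have hYp : Y.PosSemidef := hP₁p.conjTranspose_mul_mul_same U
  have hR : diagonal r = Y - (1 - X) := by
    calc diagonal r = (Uᴴ * U) * diagonal r * (Uᴴ * U) := by rw [hUU', one_mul, mul_one]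
      _ = Uᴴ * M * U := by rw [hsp]; simp only [mul_assoc]
      _ = Y - (1 - X) := by
        rw [hM, mul_sub, sub_mul, mul_sub, sub_mul, mul_one, hUU']
  have hXX : X * X = X := by
    calc X * X = Uᴴ * (diagonal ε * ((U * Uᴴ) * (diagonal ε * U))) := by
          simp only [hX, mul_assoc]
      _ = X := by rw [hUU, one_mul, ← mul_assoc (diagonal ε), hεε, hX, mul_assoc Uᴴ]
  have hXY : X * Y = Y := by
    calc X * Y = Uᴴ * (diagonal ε * ((U * Uᴴ) * (P₁ * U))) := by
          simp only [hX, hY, mul_assoc]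
      _ = Y := by rw [hUU, one_mul, ← mul_assoc (diagonal ε), hεP, hY, mul_assoc Uᴴ]
  have hXR : X * diagonal r = Y := by
    rw [hR, mul_sub, mul_sub, mul_one, hXX, hXY, sub_self, sub_zero]
  have hXRe : ∀ i j, X i j * r j = Y i j := fun i j => by rw [← hXR, mul_diagonal]
  have hXd : ∀ i j, i ≠ j → X i j = 0 := by
    intro i j hij
    have h1 : (0 : ℂ) = Y i j - (0 - X i j) := by
      have := congrFun (congrFun hR i) j
      rwa [diagonal_apply_ne _ hij, Matrix.sub_apply, Matrix.sub_apply, one_apply_ne hij] at this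
    by_cases h : r j = -1
    · have h2 : X j j = 0 := by
        refine le_antisymm ?_ hXp.diag_nonneg
        have h3 := hXRe j j
        have h4 : (0 : ℂ) ≤ Y j j := hYp.diag_nonneg
        rw [← h3, h, mul_neg_one] at h4
        simpa using h4
      exact posSemidef_apply_eq_zero_right hXp h2 i
    · have h2 : X i j * (1 + r j) = 0 := by
        linear_combination hXRe i j - h1
      refine (mul_eq_zero.1 h2).resolve_right fun h3 => h ?_
      linear_combination h3
  have hXdiag : X = diagonal (fun i => X i i) := by
    ext i j
    by_cases h : i = j
    · subst h; simp
    · rw [hXd i j h, diagonal_apply_ne _ h]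
  have hreal : ∀ {z : ℂ}, 0 ≤ z → ((z.re : ℝ) : ℂ) = z := fun hz =>
    Complex.ext rfl (Complex.le_def.1 hz).2
  have hYdiag : Y = diagonal (fun i => ((Y i i).re : ℂ)) := by
    ext i j
    by_cases h : i = j
    · subst h; simp [hreal hYp.diag_nonneg]
    · rw [← hXRe, hXd i j h, zero_mul, diagonal_apply_ne _ h]
  have hZp : (Uᴴ * Q₁ * U).PosSemidef := hQ₁p.conjTranspose_mul_mul_same U
  set Z := Uᴴ * Q₁ * U with hZ
  have hZX : Z = X - Y := by
    rw [hZ, hX, hY, ← hsum, mul_add, add_mul, add_sub_cancel_left]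
  have hZdiag : Z = diagonal (fun i => ((Z i i).re : ℂ)) := by
    ext i j
    by_cases h : i = j
    · subst h; simp [hreal hZp.diag_nonneg]
    · rw [hZX, Matrix.sub_apply, ← hXRe, hXd i j h, zero_mul, diagonal_apply_ne _ h, sub_self]
  have hUback : ∀ A : Matrix n n ℂ, U * (Uᴴ * A * U) * Uᴴ = A := fun A => by
    calc U * (Uᴴ * A * U) * Uᴴ = (U * Uᴴ) * A * (U * Uᴴ) := by simp only [mul_assoc]
      _ = A := by rw [hUU, one_mul, mul_one]
  refine ⟨W * U, fun i => (Y i i).re, fun i => (Z i i).re,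
    hW.mul (IsUnit.of_mul_eq_one _ hUU), fun i => (Complex.le_def.1 hYp.diag_nonneg).1,
    fun i => (Complex.le_def.1 hZp.diag_nonneg).1, ?_, ?_⟩
  · rw [← hYdiag, conjTranspose_mul]
    calc P = W * (U * Y * Uᴴ) * Wᴴ := by rw [hY, hUback, hback]
      _ = _ := by simp only [mul_assoc]
  · rw [← hZdiag, conjTranspose_mul]
    calc Q = W * (U * Z * Uᴴ) * Wᴴ := by rw [hZ, hUback, hback]
      _ = _ := by simp only [mul_assoc]

lemma canonicalForm_zero_right (k l : ℕ) (a : Fin l → ℝ) (γ : ℝ) :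
    canonicalForm k l 0 a γ =
      diagonal (Sum.elim (fun _ => 0) (Sum.elim (fun j => unitPhase (a j)) fun _ => 0)) := by
  ext i j
  rcases i with i | i | ⟨-, i⟩
  · rcases j with j | j | ⟨-, j⟩
    · by_cases h : i = j
      · simp [canonicalForm, h]
      · simp [canonicalForm, h]
    · simp [canonicalForm]
    · exact j.elim0
  · rcases j with j | j | ⟨-, j⟩
    · simp [canonicalForm]
    · simp [canonicalForm, diagonal_apply, unitPhase]
    · exact j.elim0
  · exact i.elim0

/-- The numerical range of a matrix of the form `e^{iα} P + e^{iβ} Q` lies in a half-plane. -/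
lemma isSemisectorial_combine {n : Type*} [Fintype n] {α β : ℝ}
    (hs : 0 ≤ Real.sin (β - α)) {P Q : Matrix n n ℂ} (hP : P.PosSemidef) (hQ : Q.PosSemidef) :
    IsSemisectorial (unitPhase α • P + unitPhase β • Q) := by
  have key : ∀ z ∈ numericalRange (unitPhase α • P + unitPhase β • Q),
      0 ≤ (unitPhase (-α) * z).im := by
    rintro z ⟨x, -, rfl⟩
    obtain ⟨hp1, hp2⟩ := Complex.le_def.1 (hP.dotProduct_mulVec_nonneg x)
    obtain ⟨hq1, hq2⟩ := Complex.le_def.1 (hQ.dotProduct_mulVec_nonneg x)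
    simp only [add_mulVec, smul_mulVec, dotProduct_add, dotProduct_smul, smul_eq_mul]
    generalize star x ⬝ᵥ (P *ᵥ x) = p at *
    generalize star x ⬝ᵥ (Q *ᵥ x) = q at *
    have h1 : (unitPhase (-α) * (unitPhase α * p + unitPhase β * q)).im =
        q.re * Real.sin (β - α) := by
      rw [mul_add, ← mul_assoc, mul_comm (unitPhase (-α)) (unitPhase α), unitPhase_mul_neg,
        Real.sin_sub]
      simp only [unitPhase_eq, Complex.add_im, Complex.mul_im, Complex.mul_re, Complex.add_re,
        Complex.ofReal_re, Complex.ofReal_im, Complex.I_re, Complex.I_im, Real.cos_neg,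
        Real.sin_neg, Complex.one_im, Complex.one_re, ← hp2, ← hq2, Complex.zero_im]
      ring
    rw [h1]
    exact mul_nonneg hq1 hs
  intro h
  obtain ⟨ε, hε, hball⟩ := Metric.isOpen_iff.1 isOpen_interior 0 h
  -- a point near the origin on the wrong side of the line through `e^{iα}`
  have hmem : -((ε / 2 : ℝ) * Complex.I * unitPhase α) ∈ Metric.ball (0 : ℂ) ε := by
    have hn : ‖unitPhase α‖ = 1 := by
      rw [unitPhase, mul_comm, Complex.norm_exp_ofReal_mul_I]
    rw [mem_ball_zero_iff, norm_neg, norm_mul, norm_mul, hn, Complex.norm_I, mul_one, mul_one,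
      Complex.norm_real, Real.norm_of_nonneg (by linarith)]
    linarith
  have := key _ (interior_subset (hball hmem))
  have h2 : unitPhase (-α) * -((ε / 2 : ℝ) * Complex.I * unitPhase α) =
      -((ε / 2 : ℝ) * Complex.I) := by
    linear_combination (-((ε / 2 : ℝ) * Complex.I)) * unitPhase_mul_neg α
  rw [h2] at this
  simp at this
  linarith

lemma smul_congr_add_smul_congr (x y : ℂ) (T D E : Matrix n n ℂ) :
    x • (T * D * Tᴴ) + y • (T * E * Tᴴ) = T * (x • D + y • E) * Tᴴ := by
  simp only [mul_add, add_mul, mul_smul_comm, smul_mul_assoc]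

/-- Because `β - α < π`, the canonical form of a phase-bounded matrix is diagonal, with entries
that vanish or have arguments in `[α, β]`. -/
lemma exists_diagonal_of_mem_pbCone {α β : ℝ} (hlt : β - α < Real.pi) {C : Matrix n n ℂ}
    (hC : C ∈ pbCone α β) : ∃ (T : Matrix n n ℂ) (d : n → ℂ), C = T * diagonal d * Tᴴ ∧
      ∀ i, d i = 0 ∨ ∃ t, α ≤ t ∧ t ≤ β ∧ d i = unitPhase t := by
  obtain ⟨φ, ⟨-, ⟨k, l, m, a, γ, e, T, -, hC, rfl⟩, -⟩, hφ⟩ := hC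
  -- a `2 × 2` block would contribute two phases at distance `π`
  have hm : m = 0 := by
    by_contra hm
    have h1 := (hφ (γ + Real.pi / 2) (by simp [canonicalPhases, Multiset.mem_replicate, hm])).2
    have h2 := (hφ (γ - Real.pi / 2) (by simp [canonicalPhases, Multiset.mem_replicate, hm])).1
    linarith
  subst hm
  have ha : ∀ j, α ≤ a j ∧ a j ≤ β := fun j => hφ _ (by simp [canonicalPhases])
  rw [canonicalForm_zero_right, reindex_apply, submatrix_diagonal_equiv] at hC
  refine ⟨T, _, hC, fun i => ?_⟩
  obtain ⟨x, rfl⟩ := e.surjective i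
  rw [Function.comp_apply, Equiv.symm_apply_apply]
  rcases x with x | x | x
  · exact Or.inl rfl
  · exact Or.inr ⟨a x, (ha x).1, (ha x).2, rfl⟩
  · exact Or.inl rfl

lemma exists_combine_of_mem_pbCone {α β : ℝ} (hpos : 0 < β - α) (hlt : β - α < Real.pi)
    {C : Matrix n n ℂ} (hC : C ∈ pbCone α β) :
    ∃ P Q : Matrix n n ℂ, P.PosSemidef ∧ Q.PosSemidef ∧
      C = unitPhase α • P + unitPhase β • Q := by
  have hs : 0 < Real.sin (β - α) := Real.sin_pos_of_pos_of_lt_pi hpos hlt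
  obtain ⟨T, d, rfl, hd⟩ := exists_diagonal_of_mem_pbCone hlt hC
  have hsplit : ∀ i, ∃ p q : ℝ, 0 ≤ p ∧ 0 ≤ q ∧ d i = unitPhase α * p + unitPhase β * q := by
    intro i
    rcases hd i with h | ⟨t, h1, h2, h⟩
    · exact ⟨0, 0, le_rfl, le_rfl, by simp [h]⟩
    · refine ⟨Real.sin (β - t) / Real.sin (β - α), Real.sin (t - α) / Real.sin (β - α),
        div_nonneg (Real.sin_nonneg_of_nonneg_of_le_pi ?_ ?_) hs.le,
        div_nonneg (Real.sin_nonneg_of_nonneg_of_le_pi ?_ ?_) hs.le, ?_⟩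
      any_goals linarith
      have hsc : (Real.sin (β - α) : ℂ) ≠ 0 := by exact_mod_cast hs.ne'
      rw [h, Complex.ofReal_div, Complex.ofReal_div, mul_div_assoc', mul_div_assoc', ← add_div,
        eq_div_iff hsc]
      linear_combination sin_smul_unitPhase α β t
  choose p q hp hq hpq using hsplit
  refine ⟨T * diagonal (fun i => (p i : ℂ)) * Tᴴ, T * diagonal (fun i => (q i : ℂ)) * Tᴴ,
    (PosSemidef.diagonal fun i => ?_).mul_mul_conjTranspose_same T,
    (PosSemidef.diagonal fun i => ?_).mul_mul_conjTranspose_same T, ?_⟩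
  · simpa using hp i
  · simpa using hq i
  · rw [smul_congr_add_smul_congr, ← diagonal_smul, ← diagonal_smul, diagonal_add]
    congr 3
    ext i
    simp [hpq]

/-- A simultaneous diagonalization of `P` and `Q` by congruence becomes the canonical form once
the nonzero diagonal entries of `e^{iα} P + e^{iβ} Q` are scaled to the unit circle. -/
lemma combine_mem_pbCone {α β : ℝ} (hpos : 0 < β - α) (hlt : β - α < Real.pi)
    {P Q : Matrix n n ℂ} (hP : P.PosSemidef) (hQ : Q.PosSemidef) :
    unitPhase α • P + unitPhase β • Q ∈ pbCone α β := by
  have hs : 0 < Real.sin (β - α) := Real.sin_pos_of_pos_of_lt_pi hpos hlt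
  have hsemi := isSemisectorial_combine hs.le hP hQ
  obtain ⟨T, p, q, hT, hp, hq, hPT, hQT⟩ := exists_simultaneous_diagonal hP hQ
  -- where both coefficients vanish the radius `1` and the phase `α` are placeholders
  have hpolar : ∀ i, ∃ r a : ℝ, 0 < r ∧ α ≤ a ∧ a ≤ β ∧ (p i ≠ 0 ∨ q i ≠ 0 →
      (p i : ℂ) * unitPhase α + q i * unitPhase β = r * unitPhase a) := by
    intro i
    by_cases h : p i ≠ 0 ∨ q i ≠ 0
    · obtain ⟨r, a, h1, h2, h3, h4⟩ := exists_unitPhase_eq hpos hlt (hp i) (hq i) h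
      exact ⟨r, a, h1, h2, h3, fun _ => h4⟩
    · exact ⟨1, α, one_pos, le_rfl, by linarith, fun h' => absurd h' h⟩
  choose r a hr ha1 ha2 hra using hpolar
  classical
  set z : n → Prop := fun i => p i = 0 ∧ q i = 0 with hz
  set f := (Fintype.equivFin {i // ¬ z i}).symm
  set e : Fin (Fintype.card {i // z i}) ⊕ (Fin (Fintype.card {i // ¬ z i}) ⊕ Fin 2 × Fin 0) ≃ n :=
    (Equiv.sumCongr (Fintype.equivFin {i // z i}).symm
      ((Equiv.sumEmpty _ _).trans f)).trans (Equiv.sumCompl z)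
  refine ⟨canonicalPhases _ 0 (fun j => a (f j)) 0, ⟨hsemi, ⟨_, _, 0, fun j => a (f j), 0, e,
    T * diagonal (fun i => ((√(r i) : ℝ) : ℂ)), hT.mul ?_, ?_, rfl⟩, α, ?_⟩, ?_⟩
  · rw [isUnit_diagonal, Pi.isUnit_iff]
    exact fun i => IsUnit.mk0 _ (by exact_mod_cast (Real.sqrt_pos.2 (hr i)).ne')
  · rw [canonicalForm_zero_right, reindex_apply, submatrix_diagonal_equiv, conjTranspose_mul,
      diagonal_conjTranspose, hPT, hQT, smul_congr_add_smul_congr, ← diagonal_smul,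
      ← diagonal_smul, diagonal_add]
    have hassoc : ∀ A B D : Matrix n n ℂ, T * A * B * (D * Tᴴ) = T * (A * B * D) * Tᴴ := by
      intro A B D
      simp only [mul_assoc]
    rw [hassoc, diagonal_mul_diagonal, diagonal_mul_diagonal]
    congr 3
    ext i
    obtain ⟨x, rfl⟩ := e.surjective i
    rcases x with x | x | x
    · have h0 : z (e (Sum.inl x)) := ((Fintype.equivFin {i // z i}).symm x).2
      simp [h0.1, h0.2]
    · have hex : e (Sum.inr (Sum.inl x)) = f x := rfl
      have h0 : ¬ z (f x) := (f x).2
      have h1 := hra (f x) (by simpa only [hz, not_and_or] using h0)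
      have h2 : ((√(r (f x)) : ℝ) : ℂ) * ((√(r (f x)) : ℝ) : ℂ) = r (f x) := by
        rw [← Complex.ofReal_mul, Real.mul_self_sqrt (hr _).le]
      simp only [hex, Pi.smul_apply, Function.comp_apply, smul_eq_mul, Pi.star_apply,
        Complex.star_def, Complex.conj_ofReal]
      rw [← hex, Equiv.symm_apply_apply, hex]
      simp only [Sum.elim_inr, Sum.elim_inl]
      linear_combination h1 - unitPhase (a (f x)) * h2
    · exact x.2.elim0
  · intro x hx
    simp only [canonicalPhases, Multiset.replicate_zero, add_zero, Multiset.mem_map] at hx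
    obtain ⟨j, -, rfl⟩ := hx
    exact ⟨ha1 _, by linarith [ha2 (f j)]⟩
  · intro x hx
    simp only [canonicalPhases, Multiset.replicate_zero, add_zero, Multiset.mem_map] at hx
    obtain ⟨j, -, rfl⟩ := hx
    exact ⟨ha1 _, ha2 _⟩

/-- A matrix is phase-bounded if and only if its two coefficients are positive semidefinite. -/
lemma mem_pbCone_iff {α β : ℝ} (hpos : 0 < β - α) (hlt : β - α < Real.pi)
    {C : Matrix n n ℂ} :
    C ∈ pbCone α β ↔ (sectorPart α β C).PosSemidef ∧ (sectorPart β α C).PosSemidef := by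
  have hs : Real.sin (β - α) ≠ 0 := (Real.sin_pos_of_pos_of_lt_pi hpos hlt).ne'
  constructor
  · intro h
    obtain ⟨P, Q, hP, hQ, rfl⟩ := exists_combine_of_mem_pbCone hpos hlt h
    rw [sectorPart_combine hs hP.1 hQ.1, sectorPart_combine' hs hP.1 hQ.1]
    exact ⟨hP, hQ⟩
  · rintro ⟨hP, hQ⟩
    rw [eq_sectorPart_combine hs C]
    exact combine_mem_pbCone hpos hlt hP hQ

end Characterization

/-! ### The obstruction from a chordless cycle -/

section ChordlessCycle

variable {V : Type*} [Fintype V] [DecidableEq V]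

/-- Vectors `u k`, one for each triangle `c 0, c k, c (k + 1)` of the fan triangulation of the
cycle `c`. In the sum of the matrices `u k * (u k)ᵀ` the contributions of the two triangles at
each diagonal `c 0, c k` cancel. -/
def fanVector (c : ℕ → V) (k : ℕ) (v : V) : ℝ :=
  if v = c 0 then 1 else if v = c k then 1 else if v = c (k + 1) then -1 else 0

/-- The values of a vector on the cycle `c` of length `m`: `1` at `c 0` and `m` elsewhere. -/
def cycleWeight (c : ℕ → V) (m : ℕ) (v : V) : ℝ :=
  if v = c 0 then 1 else if ∃ i < m, v = c i then m else 0

/-- The rank-one matrix of `cycleWeight`, with the sign reversed at the edge `c 0, c 1`. -/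
def signedCycleMatrix (c : ℕ → V) (m : ℕ) : Matrix V V ℝ := fun v w =>
  (if v = c 0 ∧ w = c 1 ∨ v = c 1 ∧ w = c 0 then -1 else 1) *
    (cycleWeight c m v * cycleWeight c m w)

lemma sum_mul_fanVector {c : ℕ → V} {k : ℕ} (h0 : c k ≠ c 0) (h1 : c (k + 1) ≠ c 0)
    (h2 : c (k + 1) ≠ c k) (f : V → ℝ) :
    ∑ v, f v * fanVector c k v = f (c 0) + f (c k) - f (c (k + 1)) := by
  have : ∀ v, f v * fanVector c k v = (if v = c 0 then f v else 0) +
      (if v = c k then f v else 0) - (if v = c (k + 1) then f v else 0) := by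
    intro v
    by_cases hv0 : v = c 0
    · subst hv0; simp [fanVector, h0.symm, h1.symm]
    by_cases hv1 : v = c k
    · subst hv1; simp [fanVector, h0, h2.symm]
    by_cases hv2 : v = c (k + 1)
    · subst hv2; simp [fanVector, h1, h2]
    · simp [fanVector, hv0, hv1, hv2]
  simp [this, Finset.sum_add_distrib, Finset.sum_sub_distrib]

/-- On a chordless cycle of length at least four there are a matrix `A` which is positive
semidefinite of rank one on every clique, and a positive semidefinite matrix with the pattern of
the graph, such that the trace of their product is negative. -/
lemma exists_obstruction_of_cycle {G : SimpleGraph V} (c : ℕ → V) {m : ℕ} (hm : 4 ≤ m)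
    (hinj : ∀ i < m, ∀ j < m, c i = c j → i = j)
    (hadj : ∀ i, i + 1 < m → G.Adj (c i) (c (i + 1))) (hlast : G.Adj (c (m - 1)) (c 0))
    (hchord : ∀ i j, j < m → i + 2 ≤ j → j + 1 < i + m → ¬ G.Adj (c i) (c j)) :
    ∃ (A : Matrix V V ℝ) (s : Finset ℕ) (u : ℕ → V → ℝ),
      (∀ K : Set V, G.IsClique K → ∃ z : V → ℝ, ∀ i ∈ K, ∀ j ∈ K, A i j = z i * z j) ∧
      (∀ i j, (i, j) ∉ loopEdges G → ∑ k ∈ s, u k i * u k j = 0) ∧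
      ∑ k ∈ s, ∑ i, ∑ j, A i j * (u k i * u k j) < 0 := by
  have hne : ∀ i < m, ∀ j < m, i ≠ j → c i ≠ c j := fun i hi j hj h h' => h (hinj i hi j hj h')
  have hw0 : cycleWeight c m (c 0) = 1 := by simp [cycleWeight]
  have hw : ∀ i < m, i ≠ 0 → cycleWeight c m (c i) = m := by
    intro i hi hi0
    rw [cycleWeight, if_neg (hne i hi 0 (by omega) hi0), if_pos ⟨i, hi, rfl⟩]
  have hu : ∀ k, 1 ≤ k → k ≤ m - 2 → ∀ i < m, fanVector c k (c i) =
      if i = 0 then 1 else if i = k then 1 else if i = k + 1 then -1 else 0 := by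
    intro k hk1 hk2 i hi
    have hiff : ∀ j < m, c i = c j ↔ i = j := fun j hj => ⟨hinj i hi j hj, fun h => h ▸ rfl⟩
    simp only [fanVector, hiff 0 (by omega), hiff k (by omega), hiff (k + 1) (by omega)]
  have hoff : ∀ k, 1 ≤ k → k ≤ m - 2 → ∀ v, (∀ i < m, v ≠ c i) → fanVector c k v = 0 := by
    intro k hk1 hk2 v hv
    simp [fanVector, hv 0 (by omega), hv k (by omega), hv (k + 1) (by omega)]
  refine ⟨signedCycleMatrix c m, Finset.Icc 1 (m - 2), fanVector c, ?_, ?_, ?_⟩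
  · intro K hK
    by_cases h01 : c 0 ∈ K ∧ c 1 ∈ K
    · -- such a clique contains no further vertex of the cycle
      have hzero : ∀ v ∈ K, v ≠ c 0 → v ≠ c 1 → cycleWeight c m v = 0 := by
        intro v hv hv0 hv1
        rw [cycleWeight, if_neg hv0, if_neg]
        rintro ⟨i, hi, rfl⟩
        have hi0 : i ≠ 0 := fun h => hv0 (h ▸ rfl)
        have hi1 : i ≠ 1 := fun h => hv1 (h ▸ rfl)
        by_cases hi2 : i = 2
        · exact hchord 0 i hi (by omega) (by omega) (hK h01.1 hv hv0.symm)
        · exact hchord 1 i hi (by omega) (by omega) (hK h01.2 hv hv1.symm)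
      have hc10 : c 1 ≠ c 0 := hne 1 (by omega) 0 (by omega) (by omega)
      refine ⟨fun v => if v = c 1 then -cycleWeight c m v else cycleWeight c m v,
        fun i hi j hj => ?_⟩
      simp only [signedCycleMatrix]
      by_cases hi1 : i = c 1
      · subst hi1
        by_cases hj1 : j = c 1
        · subst hj1; simp [hc10]
        by_cases hj0 : j = c 0
        · subst hj0; simp [hc10.symm]
        · simp [hzero j hj hj0 hj1]
      · by_cases hj1 : j = c 1
        · subst hj1
          by_cases hi0 : i = c 0
          · subst hi0; simp [hc10.symm]
          · simp [hzero i hi hi0 hi1]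
        · simp [hi1, hj1]
    · refine ⟨cycleWeight c m, fun i hi j hj => ?_⟩
      rw [signedCycleMatrix, if_neg, one_mul]
      rintro (⟨rfl, rfl⟩ | ⟨rfl, rfl⟩)
      · exact h01 ⟨hi, hj⟩
      · exact h01 ⟨hj, hi⟩
  · have hlt : ∀ a b, a < b → b < m → ¬ G.Adj (c a) (c b) →
        ∑ k ∈ Finset.Icc 1 (m - 2), fanVector c k (c a) * fanVector c k (c b) = 0 := by
      intro a b hab hb hnadj
      have hab2 : a + 2 ≤ b := by
        by_contra h
        obtain rfl : b = a + 1 := by omega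
        exact hnadj (hadj a hb)
      rcases Nat.eq_zero_or_pos a with rfl | ha
      · have hbm : b ≠ m - 1 := by
          rintro rfl
          exact hnadj hlast.symm
        have : ∀ k ∈ Finset.Icc 1 (m - 2), fanVector c k (c 0) * fanVector c k (c b) =
            (if k = b then 1 else 0) - (if k = b - 1 then 1 else 0) := by
          intro k hk
          rw [Finset.mem_Icc] at hk
          rw [hu k hk.1 hk.2 0 (by omega), hu k hk.1 hk.2 b hb, if_pos rfl, one_mul,
            if_neg (by omega)]
          split_ifs <;> first | omega | norm_num
        rw [Finset.sum_congr rfl this, Finset.sum_sub_distrib, Finset.sum_ite_eq',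
          Finset.sum_ite_eq', if_pos (Finset.mem_Icc.2 (by omega)),
          if_pos (Finset.mem_Icc.2 (by omega)), sub_self]
      · refine Finset.sum_eq_zero fun k hk => ?_
        rw [Finset.mem_Icc] at hk
        rw [hu k hk.1 hk.2 a (by omega), hu k hk.1 hk.2 b hb, if_neg (by omega),
          if_neg (show b ≠ 0 by omega)]
        split_ifs <;> first | omega | norm_num
    intro i j hij
    simp only [loopEdges, Set.mem_ofPred_eq, not_or] at hij
    by_cases hi : ∃ a < m, i = c a
    · by_cases hj : ∃ b < m, j = c b
      · obtain ⟨a, ha, rfl⟩ := hi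
        obtain ⟨b, hb, rfl⟩ := hj
        rcases lt_trichotomy a b with h | h | h
        · exact hlt a b h hb hij.2
        · exact absurd (h ▸ rfl) hij.1
        · simp_rw [mul_comm (fanVector c _ (c a))]
          exact hlt b a h ha fun h' => hij.2 h'.symm
      · push Not at hj
        refine Finset.sum_eq_zero fun k hk => ?_
        rw [Finset.mem_Icc] at hk
        rw [hoff k hk.1 hk.2 j hj, mul_zero]
    · push Not at hi
      refine Finset.sum_eq_zero fun k hk => ?_
      rw [Finset.mem_Icc] at hk
      rw [hoff k hk.1 hk.2 i hi, zero_mul]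
  · have hc10 : c 1 ≠ c 0 := hne 1 (by omega) 0 (by omega) (by omega)
    -- only the triangle containing the edge `c 0, c 1` sees the reversed sign
    have hval : ∀ k ∈ Finset.Icc 1 (m - 2), ∑ i, ∑ j, signedCycleMatrix c m i j *
        (fanVector c k i * fanVector c k j) = 1 - if k = 1 then 4 * (m : ℝ) else 0 := by
      intro k hk
      rw [Finset.mem_Icc] at hk
      have n0 : c k ≠ c 0 := hne _ (by omega) _ (by omega) (by omega)
      have n1 : c (k + 1) ≠ c 0 := hne _ (by omega) _ (by omega) (by omega)
      have n2 : c (k + 1) ≠ c k := hne _ (by omega) _ (by omega) (by omega)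
      have n3 : c (k + 1) ≠ c 1 := hne _ (by omega) _ (by omega) (by omega)
      have hrow : ∀ i, ∑ j, signedCycleMatrix c m i j * (fanVector c k i * fanVector c k j) =
          (signedCycleMatrix c m i (c 0) + signedCycleMatrix c m i (c k) -
            signedCycleMatrix c m i (c (k + 1))) * fanVector c k i := by
        intro i
        rw [← sum_mul_fanVector n0 n1 n2, Finset.sum_mul]
        exact Finset.sum_congr rfl fun j _ => by ring
      rw [Finset.sum_congr rfl fun i _ => hrow i, sum_mul_fanVector n0 n1 n2]
      by_cases hk1 : k = 1
      · subst hk1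
        simp [signedCycleMatrix, hw0, hw 1 (by omega) (by omega), hw 2 (by omega) (by omega),
          hc10, hc10.symm, n1, n2]
        ring
      · have n4 : c k ≠ c 1 := hne _ (by omega) _ (by omega) hk1
        simp [signedCycleMatrix, hw0, hw k (by omega) (by omega),
          hw (k + 1) (by omega) (by omega), hk1, n0, n1, n3, n4, hc10.symm]
    rw [Finset.sum_congr rfl hval, Finset.sum_sub_distrib, Finset.sum_ite_eq',
      if_pos (Finset.mem_Icc.2 (by omega))]
    simp only [Finset.sum_const, Nat.card_Icc, mul_one, nsmul_eq_mul]
    have h1 : ((m - 2 + 1 - 1 : ℕ) : ℝ) ≤ m := by exact_mod_cast (by omega)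
    have h2 : (4 : ℝ) ≤ m := by exact_mod_cast hm
    linarith

lemma exists_obstruction_of_not_isChordal {G : SimpleGraph V} (hG : ¬ IsChordal G) :
    ∃ (A : Matrix V V ℝ) (s : Finset ℕ) (u : ℕ → V → ℝ),
      (∀ K : Set V, G.IsClique K → ∃ z : V → ℝ, ∀ i ∈ K, ∀ j ∈ K, A i j = z i * z j) ∧
      (∀ i j, (i, j) ∉ loopEdges G → ∑ k ∈ s, u k i * u k j = 0) ∧
      ∑ i, ∑ j, A i j * ∑ k ∈ s, u k i * u k j < 0 := by
  simp only [IsChordal, not_forall, not_exists, not_and] at hG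
  obtain ⟨v, p, hp, hlen, hchord⟩ := hG
  have hlast : G.Adj (p.getVert (p.length - 1)) (p.getVert 0) := by
    have := p.adj_getVert_succ (i := p.length - 1) (by omega)
    rw [Nat.sub_add_cancel (by omega), p.getVert_length] at this
    rwa [p.getVert_zero]
  obtain ⟨A, s, u, hA, hu, hneg⟩ := exists_obstruction_of_cycle p.getVert hlen
    (fun i hi j hj => hp.getVert_injOn' (show i ≤ p.length - 1 by omega)
      (show j ≤ p.length - 1 by omega))
    (fun i hi => p.adj_getVert_succ (by omega)) hlast hchord
  refine ⟨A, s, u, hA, hu, ?_⟩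
  simp only [Finset.mul_sum]
  rwa [Finset.sum_congr rfl fun i _ => Finset.sum_comm, Finset.sum_comm]

end ChordlessCycle

/-! ### The four cones -/

section Cones

variable {V : Type*} [Fintype V] [DecidableEq V] {α β : ℝ}

lemma realify_injective {V : Type*} :
    Function.Injective (realify : Set (Matrix V V ℂ) → Set _) := by
  have key : ∀ {S T : Set (Matrix V V ℂ)}, realify S = realify T → S ⊆ T := by
    intro S T h C hC
    have hp : ((realPart C, imaginaryPart C) :
        selfAdjoint (Matrix V V ℂ) × selfAdjoint (Matrix V V ℂ)) ∈ realify S := by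
      change (realPart C : Matrix V V ℂ) + Complex.I • (imaginaryPart C : Matrix V V ℂ) ∈ S
      rwa [realPart_add_I_smul_imaginaryPart]
    rw [h] at hp
    change (realPart C : Matrix V V ℂ) + Complex.I • (imaginaryPart C : Matrix V V ℂ) ∈ T at hp
    rwa [realPart_add_I_smul_imaginaryPart] at hp
  exact fun S T h => (key h).antisymm (key h.symm)

lemma zero_mem_pbCone {n : Type*} [Fintype n] [DecidableEq n] (hpos : 0 < β - α)
    (hlt : β - α < Real.pi) : (0 : Matrix n n ℂ) ∈ pbCone α β := by
  rw [mem_pbCone_iff hpos hlt, sectorPart_zero, sectorPart_zero]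
  exact ⟨PosSemidef.zero, PosSemidef.zero⟩

lemma add_mem_pbCone {n : Type*} [Fintype n] [DecidableEq n] (hpos : 0 < β - α)
    (hlt : β - α < Real.pi) {C D : Matrix n n ℂ} (hC : C ∈ pbCone α β) (hD : D ∈ pbCone α β) :
    C + D ∈ pbCone α β := by
  rw [mem_pbCone_iff hpos hlt] at *
  rw [sectorPart_add, sectorPart_add]
  exact ⟨hC.1.add hD.1, hC.2.add hD.2⟩

lemma unitPhase_smul_mem_pbCone {n : Type*} [Fintype n] [DecidableEq n] (hpos : 0 < β - α)
    (hlt : β - α < Real.pi) {P : Matrix n n ℂ} (hP : P.PosSemidef) :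
    unitPhase α • P ∈ pbCone α β := by
  simpa using combine_mem_pbCone hpos hlt hP PosSemidef.zero

lemma unitPhase_smul_mem_pbCone' {n : Type*} [Fintype n] [DecidableEq n] (hpos : 0 < β - α)
    (hlt : β - α < Real.pi) {P : Matrix n n ℂ} (hP : P.PosSemidef) :
    unitPhase β • P ∈ pbCone α β := by
  simpa using combine_mem_pbCone hpos hlt PosSemidef.zero hP

lemma unitPhase_ne_zero (θ : ℝ) : unitPhase θ ≠ 0 := Complex.exp_ne_zero _

lemma rank_smul_vecMulVec_eq_one {e : ℂ} (he : e ≠ 0) {x : V → ℂ} (hx : x ≠ 0) :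
    (e • vecMulVec x (star x)).rank = 1 := by
  rw [← smul_vecMulVec]
  refine le_antisymm (rank_vecMulVec_le _ _) (Nat.one_le_iff_ne_zero.2 fun h => ?_)
  rw [Matrix.rank, Submodule.finrank_eq_zero, LinearMap.range_eq_bot] at h
  obtain ⟨i, hi⟩ := Function.ne_iff.1 hx
  have h0 := congrFun (LinearMap.congr_fun h (Pi.single i 1)) i
  rw [mulVecLin_apply, mulVec_single_one] at h0
  simp [vecMulVec_apply, he] at h0
  exact hi h0

/-- A matrix of rank one is an outer product. -/
lemma exists_eq_mul_of_rank_eq_one {D : Matrix V V ℂ} (hD : D.rank = 1) :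
    ∃ x y : V → ℂ, ∀ i j, D i j = x i * y j := by
  rw [Matrix.rank] at hD
  obtain ⟨x, hx⟩ := (finrank_le_one_iff (K := ℂ)).1 hD.le
  choose y hy using fun j => hx ⟨D *ᵥ Pi.single j 1, Pi.single j 1, rfl⟩
  refine ⟨x, y, fun i j => ?_⟩
  have h : y j * (x : V → ℂ) i = (D *ᵥ Pi.single j 1) i :=
    congrFun (congrArg Subtype.val (hy j)) i
  rw [mulVec_single_one] at h
  rw [mul_comm, h]
  rfl

lemma decomposableCone_subset (hpos : 0 < β - α) (hlt : β - α < Real.pi) (G : SimpleGraph V) :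
    decomposableCone α β G ⊆ pbConeGraph α β G := by
  rintro C ⟨hE, N, D, rfl, hD⟩
  refine ⟨hE, ?_⟩
  exact Finset.sum_induction D (· ∈ pbCone α β) (fun _ _ => add_mem_pbCone hpos hlt)
    (zero_mem_pbCone hpos hlt) fun i _ => (hD i).2.2

lemma completableCone_subset (hpos : 0 < β - α) (hlt : β - α < Real.pi) (G : SimpleGraph V) :
    completableCone α β G ⊆ partialPbCone α β G := by
  rintro C ⟨B, hB, hC⟩ K hK
  have : C.submatrix (fun i : K => (i : V)) (fun i : K => (i : V)) =
      (C + B).submatrix (fun i : K => (i : V)) (fun i : K => (i : V)) := by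
    ext i j
    have : B i j = 0 := by
      refine hB i j fun h => h ?_
      by_cases hij : (i : V) = j
      · exact Or.inl hij
      · exact Or.inr (hK i.2 j.2 hij)
    simp [this]
  rw [mem_pbCone_iff hpos hlt] at hC
  rw [this, mem_pbCone_iff hpos hlt, sectorPart_submatrix, sectorPart_submatrix]
  exact ⟨hC.1.submatrix _, hC.2.submatrix _⟩

lemma mem_decomposableCone_of_mem_closure {G : SimpleGraph V} {C : Matrix V V ℂ}
    (hC : C ∈ AddSubmonoid.closure {D : Matrix V V ℂ | D.rank = 1 ∧ D ∈ pbConeGraph α β G}) :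
    C ∈ decomposableCone α β G := by
  induction hC using AddSubmonoid.closure_induction with
  | mem D hD => exact ⟨hD.2.1, 1, fun _ => D, by simp, fun _ => hD⟩
  | zero => exact ⟨fun _ _ _ => rfl, 0, Fin.elim0, by simp, fun i => i.elim0⟩
  | add A B _ _ hA hB =>
    obtain ⟨hAE, M, D, rfl, hD⟩ := hA
    obtain ⟨hBE, N, F, rfl, hF⟩ := hB
    refine ⟨fun i j hij => by rw [Matrix.add_apply, hAE i j hij, hBE i j hij, add_zero], M + N,
      Fin.append D F, by simp [Fin.sum_univ_add], fun i => ?_⟩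
    refine Fin.addCases (fun i => ?_) (fun i => ?_) i
    · rw [Fin.append_left]; exact hD i
    · rw [Fin.append_right]; exact hF i

lemma IsChordal.decomposableCone_eq {G : SimpleGraph V} (hG : IsChordal G) (hpos : 0 < β - α)
    (hlt : β - α < Real.pi) : decomposableCone α β G = pbConeGraph α β G := by
  refine (decomposableCone_subset hpos hlt G).antisymm ?_
  rintro C ⟨hE, hC⟩
  have hs : Real.sin (β - α) ≠ 0 := (Real.sin_pos_of_pos_of_lt_pi hpos hlt).ne'
  rw [mem_pbCone_iff hpos hlt] at hC
  refine mem_decomposableCone_of_mem_closure ?_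
  have key : ∀ e : ℂ, e ≠ 0 → (∀ P : Matrix V V ℂ, P.PosSemidef → e • P ∈ pbCone α β) →
      ∀ P : Matrix V V ℂ, P.PosSemidef → P ∈ withPattern (loopEdges G) →
      e • P ∈ AddSubmonoid.closure {D : Matrix V V ℂ | D.rank = 1 ∧ D ∈ pbConeGraph α β G} := by
    intro e he hmem P hP hPE
    have h := hG.mem_closure_vecMulVec hP hPE
    clear hP hPE
    induction h using AddSubmonoid.closure_induction with
    | mem D hD =>
      obtain ⟨x, rfl, hxE⟩ := hD
      by_cases hx : x = 0
      · subst hx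
        simp
      · refine AddSubmonoid.subset_closure ⟨rank_smul_vecMulVec_eq_one he hx, ?_,
          hmem _ (posSemidef_vecMulVec_self_star x)⟩
        intro i j hij
        rw [Matrix.smul_apply, hxE i j hij, smul_zero]
    | zero => simp
    | add A B _ _ hA hB => rw [smul_add]; exact add_mem hA hB
  rw [eq_sectorPart_combine hs C]
  exact add_mem
    (key _ (unitPhase_ne_zero α) (fun P => unitPhase_smul_mem_pbCone hpos hlt) _ hC.1
      (sectorPart_mem_withPattern hE α β))
    (key _ (unitPhase_ne_zero β) (fun P => unitPhase_smul_mem_pbCone' hpos hlt) _ hC.2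
      (sectorPart_mem_withPattern hE β α))

lemma IsChordal.completableCone_eq {G : SimpleGraph V} (hG : IsChordal G) (hpos : 0 < β - α)
    (hlt : β - α < Real.pi) : completableCone α β G = partialPbCone α β G := by
  refine (completableCone_subset hpos hlt G).antisymm fun C hC => ?_
  have hs : Real.sin (β - α) ≠ 0 := (Real.sin_pos_of_pos_of_lt_pi hpos hlt).ne'
  have hC' := fun K hK => (mem_pbCone_iff hpos hlt).1 (hC K hK)
  simp only [sectorPart_submatrix] at hC'
  obtain ⟨M, hM, hMC⟩ := hG.exists_posSemidef_completion fun K hK => (hC' K hK).1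
  obtain ⟨N, hN, hNC⟩ := hG.exists_posSemidef_completion fun K hK => (hC' K hK).2
  refine ⟨unitPhase α • M + unitPhase β • N - C, fun i j hij => ?_, ?_⟩
  · rw [Set.mem_compl_iff, not_not] at hij
    have h := congrFun (congrFun (eq_sectorPart_combine hs C) i) j
    rw [Matrix.add_apply, Matrix.smul_apply, Matrix.smul_apply] at h
    rw [Matrix.sub_apply, Matrix.add_apply, Matrix.smul_apply, Matrix.smul_apply, hMC i j hij,
      hNC i j hij, ← h, sub_self]
  · rw [add_sub_cancel]
    exact combine_mem_pbCone hpos hlt hM hN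

lemma sum_sum_mul_sum_eq {V : Type*} [Fintype V] (M : Matrix V V ℂ) (s : Finset ℕ)
    (u : ℕ → V → ℝ) :
    ∑ i, ∑ j, M i j * ((∑ k ∈ s, u k i * u k j : ℝ) : ℂ) =
      ∑ k ∈ s, star (fun i => (u k i : ℂ)) ⬝ᵥ (M *ᵥ fun i => (u k i : ℂ)) := by
  simp only [Complex.ofReal_sum, Finset.mul_sum]
  rw [Finset.sum_congr rfl fun i _ => Finset.sum_comm, Finset.sum_comm]
  refine Finset.sum_congr rfl fun k _ => ?_
  simp only [dotProduct, mulVec, Finset.mul_sum, Pi.star_apply, Complex.star_def,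
    Complex.conj_ofReal, Complex.ofReal_mul]
  exact Finset.sum_congr rfl fun i _ => Finset.sum_congr rfl fun j _ => by ring

/-- The obstruction matrix `A` is partially positive semidefinite, but a positive semidefinite
completion would have a nonnegative pairing with the test matrix `∑ k, u k * (u k)ᵀ`. -/
lemma isChordal_of_completableCone_eq {G : SimpleGraph V} (hpos : 0 < β - α)
    (hlt : β - α < Real.pi) (h : completableCone α β G = partialPbCone α β G) :
    IsChordal G := by
  by_contra hG
  have hs : Real.sin (β - α) ≠ 0 := (Real.sin_pos_of_pos_of_lt_pi hpos hlt).ne'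
  obtain ⟨A, s, u, hA, hP, hneg⟩ := exists_obstruction_of_not_isChordal hG
  have hAsymm : ∀ i j, (i, j) ∈ loopEdges G → A i j = A j i := by
    intro i j hij
    rcases eq_or_ne i j with rfl | hne
    · rfl
    · obtain ⟨z, hz⟩ := hA {i, j}
        (SimpleGraph.isClique_pair.2 fun _ => hij.resolve_left hne)
      rw [hz i (by simp) j (by simp), hz j (by simp) i (by simp), mul_comm]
  set A' : Matrix V V ℂ := A.map Complex.ofReal with hA'
  have hmem : unitPhase α • A' ∈ partialPbCone α β G := by
    intro K hK
    obtain ⟨z, hz⟩ := hA K hK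
    have : (unitPhase α • A').submatrix (fun i : K => (i : V)) (fun i : K => (i : V)) =
        unitPhase α • vecMulVec (fun i : K => (z i : ℂ)) (star fun i : K => (z i : ℂ)) := by
      ext i j
      simp [hA', hz i i.2 j j.2, vecMulVec_apply]
    rw [this]
    exact unitPhase_smul_mem_pbCone hpos hlt (posSemidef_vecMulVec_self_star _)
  rw [← h] at hmem
  obtain ⟨B, hB, hC⟩ := hmem
  have hM := ((mem_pbCone_iff hpos hlt).1 hC).1
  set M := sectorPart α β (unitPhase α • A' + B) with hMdef
  have hMA : ∀ i j, (i, j) ∈ loopEdges G → M i j = A i j := by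
    intro i j hij
    have h1 : unitPhase (-β) * unitPhase α - unitPhase β * unitPhase (-α) =
      -(2 * Real.sin (β - α) * Complex.I) := unitPhase_mul_sub α β
    have hsc : (Real.sin (β - α) : ℂ) ≠ 0 := by exact_mod_cast hs
    rw [hMdef, sectorPart_apply, Matrix.add_apply, Matrix.add_apply, hB i j (by simpa using hij),
      hB j i (by simpa using loopEdges_symm hij), add_zero, add_zero, Matrix.smul_apply,
      Matrix.smul_apply, hA', map_apply, map_apply, hAsymm j i (loopEdges_symm hij), smul_eq_mul,
      star_mul', star_unitPhase, Complex.star_def, Complex.conj_ofReal, ← mul_assoc, ← mul_assoc,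
      ← sub_mul, h1]
    field_simp
    linear_combination (-(A i j : ℂ)) * Complex.I_sq
  have hnn : (0 : ℂ) ≤ ∑ i, ∑ j, M i j * ((∑ k ∈ s, u k i * u k j : ℝ) : ℂ) := by
    rw [sum_sum_mul_sum_eq]
    exact Finset.sum_nonneg fun k _ => hM.dotProduct_mulVec_nonneg _
  have heq : ∑ i, ∑ j, M i j * ((∑ k ∈ s, u k i * u k j : ℝ) : ℂ) =
      ((∑ i, ∑ j, A i j * ∑ k ∈ s, u k i * u k j : ℝ) : ℂ) := by
    simp only [Complex.ofReal_sum (s := Finset.univ)]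
    refine Finset.sum_congr rfl fun i _ => Finset.sum_congr rfl fun j _ => ?_
    by_cases hij : (i, j) ∈ loopEdges G
    · rw [hMA i j hij, Complex.ofReal_mul]
    · rw [hP i j hij]; simp
  rw [heq, Complex.zero_le_real] at hnn
  exact hnn.not_gt hneg

/-- The test matrix `∑ k, u k * (u k)ᵀ` has the pattern of the graph, but a sum of rank-one
matrices with that pattern, each of them supported on a clique, would have a nonnegative pairing
with the obstruction matrix `A`. -/
lemma isChordal_of_decomposableCone_eq {G : SimpleGraph V} (hpos : 0 < β - α)
    (hlt : β - α < Real.pi) (h : decomposableCone α β G = pbConeGraph α β G) :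
    IsChordal G := by
  by_contra hG
  have hs : Real.sin (β - α) ≠ 0 := (Real.sin_pos_of_pos_of_lt_pi hpos hlt).ne'
  obtain ⟨A, s, u, hA, hP, hneg⟩ := exists_obstruction_of_not_isChordal hG
  set P : Matrix V V ℂ := fun i j => ((∑ k ∈ s, u k i * u k j : ℝ) : ℂ) with hPdef
  have hPpsd : P.PosSemidef := by
    have : P = ∑ k ∈ s, vecMulVec (fun i => (u k i : ℂ)) (star fun i => (u k i : ℂ)) := by
      ext i j
      simp [hPdef, Matrix.sum_apply, vecMulVec_apply]
    rw [this]
    exact posSemidef_sum s fun k _ => posSemidef_vecMulVec_self_star _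
  have hmem : unitPhase α • P ∈ pbConeGraph α β G := by
    refine ⟨fun i j hij => ?_, unitPhase_smul_mem_pbCone hpos hlt hPpsd⟩
    have h0 : P i j = 0 := by rw [hPdef]; simp only [hP i j hij, Complex.ofReal_zero]
    rw [Matrix.smul_apply, h0, smul_zero]
  rw [← h] at hmem
  obtain ⟨-, N, D, hsum, hD⟩ := hmem
  have hPsum : P = ∑ l, sectorPart α β (D l) := by
    have h1 := sectorPart_combine hs hPpsd.1 (isHermitian_zero (n := V) (α := ℂ))
    rw [smul_zero, add_zero, hsum, sectorPart_sum] at h1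
    exact h1.symm
  have hnn : ∀ l, (0 : ℂ) ≤ ∑ i, ∑ j, (A i j : ℂ) * sectorPart α β (D l) i j := by
    intro l
    have hpsd := ((mem_pbCone_iff hpos hlt).1 (hD l).2.2).1
    -- an entry of a rank-one matrix vanishes only together with a diagonal entry
    have hclique : G.IsClique {i | sectorPart α β (D l) i i ≠ 0} := by
      have hdiag : ∀ i, sectorPart α β (D l) i i ≠ 0 → D l i i ≠ 0 := by
        intro i hi h0
        exact hi (by rw [sectorPart_apply, h0]; simp)
      obtain ⟨x, y, hxy⟩ := exists_eq_mul_of_rank_eq_one (hD l).1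
      intro i hi j hj hij
      have hi' := hdiag i hi
      have hj' := hdiag j hj
      rw [hxy] at hi' hj'
      by_contra hnadj
      have h0 := (hD l).2.1 i j fun h => h.elim hij hnadj
      rw [hxy] at h0
      exact mul_ne_zero (left_ne_zero_of_mul hi') (right_ne_zero_of_mul hj') h0
    obtain ⟨z, hz⟩ := hA _ hclique
    have heq : ∑ i, ∑ j, (A i j : ℂ) * sectorPart α β (D l) i j =
        star (fun i => (z i : ℂ)) ⬝ᵥ (sectorPart α β (D l) *ᵥ fun i => (z i : ℂ)) := by
      simp only [dotProduct, mulVec, Finset.mul_sum, Pi.star_apply, Complex.star_def,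
        Complex.conj_ofReal]
      refine Finset.sum_congr rfl fun i _ => Finset.sum_congr rfl fun j _ => ?_
      by_cases hi : sectorPart α β (D l) i i = 0
      · rw [posSemidef_apply_eq_zero_left hpsd hi]; simp
      by_cases hj : sectorPart α β (D l) j j = 0
      · rw [posSemidef_apply_eq_zero_right hpsd hj]; simp
      rw [hz i hi j hj, Complex.ofReal_mul]
      ring
    rw [heq]
    exact hpsd.dotProduct_mulVec_nonneg _
  have htotal : ((∑ i, ∑ j, A i j * ∑ k ∈ s, u k i * u k j : ℝ) : ℂ) =
      ∑ l, ∑ i, ∑ j, (A i j : ℂ) * sectorPart α β (D l) i j := by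
    calc ((∑ i, ∑ j, A i j * ∑ k ∈ s, u k i * u k j : ℝ) : ℂ)
        = ∑ i, ∑ j, (A i j : ℂ) * P i j := by
          simp only [Complex.ofReal_sum (s := Finset.univ), Complex.ofReal_mul, hPdef]
      _ = ∑ i, ∑ j, ∑ l, (A i j : ℂ) * sectorPart α β (D l) i j := by
          simp only [hPsum, Matrix.sum_apply, Finset.mul_sum]
      _ = _ := by
          rw [Finset.sum_congr rfl fun i _ => Finset.sum_comm, Finset.sum_comm]
  have h0 := Finset.sum_nonneg fun l (_ : l ∈ Finset.univ) => hnn l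
  rw [← htotal, Complex.zero_le_real] at h0
  exact h0.not_gt hneg

end Cones

end PhaseBounded

theorem mainTheorem1 {V : Type*} [Fintype V] [DecidableEq V] (G : SimpleGraph V)
    (α β : ℝ) (hpos : 0 < β - α) (hlt : β - α < Real.pi) :
    List.TFAE [
      PhaseBounded.IsChordal G,
      PhaseBounded.realify (PhaseBounded.decomposableCone α β G) =
        PhaseBounded.realify (PhaseBounded.pbConeGraph α β G),
      PhaseBounded.realify (PhaseBounded.completableCone α β G) =
        PhaseBounded.realify (PhaseBounded.partialPbCone α β G)] := by
  rw [PhaseBounded.realify_injective.eq_iff, PhaseBounded.realify_injective.eq_iff]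
  tfae_have 1 → 2 := fun hG => hG.decomposableCone_eq hpos hlt
  tfae_have 1 → 3 := fun hG => hG.completableCone_eq hpos hlt
  tfae_have 2 → 1 := PhaseBounded.isChordal_of_decomposableCone_eq hpos hlt
  tfae_have 3 → 1 := PhaseBounded.isChordal_of_completableCone_eq hpos hlt
  tfae_finish
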